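/- Let $\mathfrak g$ be a finite-dimensional real Lie algebra with a symplectic form $\omega$ (a non-degenerate closed 2-form for the Chevalley–Eilenberg differential) and a non-degenerate symmetric bilinear form $g$, and let $V$ be the underlying vector space of $\mathfrak g$. Let $\gamma:\mathfrak g\to \mathrm{End}(V)$ be a torsion-free flat symplectic connection: $\gamma(x)y-\gamma(y)x=[x,y]$, $\gamma([x,y])=\gamma(x)\gamma(y)-\gamma(y)\gamma(x)$ and $\omega(\gamma(x)y,z)+\omega(y,\gamma(x)z)=0$. Let $\mathfrak h=\mathfrak g\ltimes_\gamma V$, with bracket $[(x,u),(y,v)]=([x,y],\gamma(x)v-\gamma(y)u)$, and put $$J(x,u)=(-u,x),\qquad \Delta((x,u),(y,v))=g(x,y)+g(u,v),$$ $$\Omega_1((x,u),(y,v))=-\omega(x,v)-\omega(u,y),\quad \Omega_2((x,u),(y,v))=\omega(x,y)-\omega(u,v),\quad \Omega_3((x,u),(y,v))=\omega(x,y)+\omega(u,v).$$ Then $J$ is an integrable complex structure on $\mathfrak h$, $\Omega_1,\Omega_2,\Omega_3$ are symplectic forms on $\mathfrak h$, and $\Delta$ is a non-degenerate symmetric bilinear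 form. An (invariant) generalized complex structure on $\mathfrak h$ is given by a maximal isotropic subspace $L$ of $(\mathfrak h\oplus\mathfrak h^*)_{\mathbb C}$, with respect to $\langle X+\alpha,Y+\beta\rangle=\frac12(\alpha(Y)+\beta(X))$, that is closed under the Courant bracket $[\![X+\alpha,Y+\beta]\!]=[X,Y]+\mathcal L_X\beta-\mathcal L_Y\alpha$ and satisfies $L\cap\overline L=0$. The complex structure $J$ gives $L_J=\mathfrak h^{1,0}\oplus\mathfrak h^{*(0,1)}$, and a symplectic form $\Omega$ gives $L_\Omega=\{X-i\iota_X\Omega: X\in\mathfrak h_{\mathbb C}\}$. The differential Gerstenhaber algebra of $L$ is $(\wedge^\bullet L,[\![-,-]\!],\wedge,\overline\partial)$, where $[\![-,-]\!]$ is the Schouten bracket extending the Courant bracket of $L$ and $\overline\partial$ is the Chevalley–Eilenberg differential of the Lie algebra $\overline L$, with $\overline L^*$ identified with $L$ through $2\langle-,-\rangle$. We write $\mathrm{DGA}(J)$ and $\mathrm{DGA}(\Omega_2)$ for those of $L_J$ and $L_{\Omega_2}$. For $\Gamma\in\wedge^2L$, viewed by contraction as a map $\overline L\to L$, let $\overline\Gamma:L\to\overline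 L$ be its conjugate; the deformation of $L$ along $\Gamma$ is $L_{\overline\Gamma}=\{\ell+\overline\Gamma(\ell):\ell\in L\}$. Suppose that $(J,\Delta)$ is pseudo-Kähler, i.e. $\Delta$ is $J$-invariant and the 2-form $\Delta(J-,-)$ is closed, and that $$(g^{-1}\omega)(\gamma(a)b)=\gamma((g^{-1}\omega)a)\,((g^{-1}\omega)b)\qquad\text{for all }a,b\in\mathfrak g,$$ where $g^{-1}\omega:V\to V$ is the map with $g((g^{-1}\omega)a,b)=\omega(a,b)$. Then there is a deformation from $J$ to the symplectic structure $\Omega_2$, up to the $B$-field transformation by the closed form $\Omega_1$: there is $\Lambda\in\wedge^2L_J$ such that $(L_J)_{t\overline\Lambda}$ is a generalized complex structure for all $t\in\mathbb R$ (equal to $L_J$ for $t=0$), and $$(L_J)_{\overline\Lambda}=\{X+\alpha+\iota_X\Omega_1: X+\alpha\in L_{\Omega_2}\}.$$ Moreover $\mathrm{DGA}(J)$ and $\mathrm{DGA}(\Omega_2)$ are isomorphic as differential Gerstenhaber algebras, by a degree-preserving isomorphism of exterior algebras respecting brackets and differentials. -/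

import Mathlib

open scoped TensorProduct

namespace GenGeom

noncomputable section

/-! ## Complexified generalized tangent space of a real Lie algebra

Invariant objects on a Lie group are identified with linear objects on its Lie algebra `𝔥`. -/

/-- The complexified generalized tangent space `(𝔥 ⊕ 𝔥^*)_ℂ = 𝔥_ℂ ⊕ (𝔥_ℂ)^*`. -/
abbrev GenTangent (𝔥 : Type*) [LieRing 𝔥] [LieAlgebra ℝ 𝔥] : Type _ :=
  (ℂ ⊗[ℝ] 𝔥) × Module.Dual ℂ (ℂ ⊗[ℝ] 𝔥)

section Basic

variable {𝔥 : Type*} [LieRing 𝔥] [LieAlgebra ℝ 𝔥]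

theorem cx_lie_add (X Y Z : ℂ ⊗[ℝ] 𝔥) : ⁅X, Y + Z⁆ = ⁅X, Y⁆ + ⁅X, Z⁆ := lie_add X Y Z

theorem cx_add_lie (X Y Z : ℂ ⊗[ℝ] 𝔥) : ⁅X + Y, Z⁆ = ⁅X, Z⁆ + ⁅Y, Z⁆ := add_lie X Y Z

theorem cx_lie_zero (X : ℂ ⊗[ℝ] 𝔥) : ⁅X, (0 : ℂ ⊗[ℝ] 𝔥)⁆ = 0 := lie_zero X

theorem cx_zero_lie (X : ℂ ⊗[ℝ] 𝔥) : ⁅(0 : ℂ ⊗[ℝ] 𝔥), X⁆ = 0 := zero_lie X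

theorem cx_lie_smul (c : ℂ) (X Y : ℂ ⊗[ℝ] 𝔥) : ⁅X, c • Y⁆ = c • ⁅X, Y⁆ := lie_smul c X Y

theorem cx_smul_lie (c : ℂ) (X Y : ℂ ⊗[ℝ] 𝔥) : ⁅c • X, Y⁆ = c • ⁅X, Y⁆ := smul_lie c X Y

theorem cx_lie_skew (X Y : ℂ ⊗[ℝ] 𝔥) : ⁅X, Y⁆ = -⁅Y, X⁆ := (lie_skew X Y).symm

/-- The natural symmetric pairing `⟨X + α, Y + β⟩ = (α(Y) + β(X)) / 2`. -/
def pairing (a b : GenTangent 𝔥) : ℂ := (1 / 2 : ℂ) * (a.2 b.1 + b.2 a.1)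

/-- The identification of the generalized tangent space with its dual,
`σ(a)(b) = 2 ⟨a, b⟩`. -/
def sigma : GenTangent 𝔥 →ₗ[ℂ] Module.Dual ℂ (GenTangent 𝔥) where
  toFun a :=
    { toFun := fun b => a.2 b.1 + b.2 a.1
      map_add' := fun b c => by simp; ring
      map_smul' := fun r b => by simp; ring }
  map_add' a b := by ext <;> simp
  map_smul' r a := by ext <;> simp

theorem sigma_apply (a b : GenTangent 𝔥) : sigma a b = a.2 b.1 + b.2 a.1 := rfl

theorem sigma_eq_two_pairing (a b : GenTangent 𝔥) : sigma a b = 2 * pairing a b := by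
  simp only [sigma_apply, pairing]; ring

/-- The Lie derivative of an invariant 1-form: `(ℒ_X β)(Y) = -β([X, Y])`. -/
def lieDer (X : ℂ ⊗[ℝ] 𝔥) (β : Module.Dual ℂ (ℂ ⊗[ℝ] 𝔥)) : Module.Dual ℂ (ℂ ⊗[ℝ] 𝔥) :=
  -(β ∘ₗ (LieAlgebra.ad ℂ (ℂ ⊗[ℝ] 𝔥) X : (ℂ ⊗[ℝ] 𝔥) →ₗ[ℂ] (ℂ ⊗[ℝ] 𝔥)))

theorem lieDer_apply (X Y : ℂ ⊗[ℝ] 𝔥) (β : Module.Dual ℂ (ℂ ⊗[ℝ] 𝔥)) :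
    lieDer X β Y = -β ⁅X, Y⁆ := rfl

/-- The Courant bracket of invariant sections,
`⟦X + α, Y + β⟧ = [X, Y] + ℒ_X β - ℒ_Y α`. The remaining term
`-(1/2) d (ι_X β - ι_Y α)` of the Courant bracket vanishes, since it is the differential of a
constant function. -/
def courant (a b : GenTangent 𝔥) : GenTangent 𝔥 :=
  (⁅a.1, b.1⁆, lieDer a.1 b.2 - lieDer b.1 a.2)

/-- Complex conjugation on `𝔥_ℂ`. -/
def conjV : (ℂ ⊗[ℝ] 𝔥) →ₛₗ[starRingEnd ℂ] (ℂ ⊗[ℝ] 𝔥) where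
  toFun := TensorProduct.map (Complex.conjAe.toLinearEquiv : ℂ →ₗ[ℝ] ℂ) (LinearMap.id : 𝔥 →ₗ[ℝ] 𝔥)
  map_add' := map_add _
  map_smul' r x := by
    induction x with
    | zero => simp
    | tmul z v => simp [TensorProduct.smul_tmul']
    | add x y hx hy => simp [hx, hy]

@[simp] theorem conjV_tmul (z : ℂ) (v : 𝔥) :
    conjV (z ⊗ₜ[ℝ] v) = (starRingEnd ℂ z) ⊗ₜ[ℝ] v := rfl

@[simp] theorem conjV_conjV (x : ℂ ⊗[ℝ] 𝔥) : conjV (conjV x) = x := by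
  induction x with
  | zero => simp
  | tmul z v => simp
  | add x y hx hy => simp [hx, hy]

/-- Complex conjugation on `(𝔥_ℂ)^*`: the conjugate of `α` is the form sending `X` to the
conjugate of `α (conj X)`. -/
def conjD : Module.Dual ℂ (ℂ ⊗[ℝ] 𝔥) →ₛₗ[starRingEnd ℂ] Module.Dual ℂ (ℂ ⊗[ℝ] 𝔥) where
  toFun α :=
    { toFun := fun X => starRingEnd ℂ (α (conjV X))
      map_add' := fun X Y => by simp
      map_smul' := fun r X => by simp }
  map_add' α β := by ext; simp
  map_smul' r α := by ext; simp

theorem conjD_apply (α : Module.Dual ℂ (ℂ ⊗[ℝ] 𝔥)) (X : ℂ ⊗[ℝ] 𝔥) :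
    conjD α X = starRingEnd ℂ (α (conjV X)) := rfl

/-- Complex conjugation on the complexified generalized tangent space. -/
def conjE : GenTangent 𝔥 →ₛₗ[starRingEnd ℂ] GenTangent 𝔥 where
  toFun a := (conjV a.1, conjD a.2)
  map_add' a b := by simp
  map_smul' r a := by simp

theorem conjE_apply (a : GenTangent 𝔥) : conjE a = (conjV a.1, conjD a.2) := rfl

/-- The conjugate of a complex subspace (conjugation is an involution, so preimage and image
agree). -/
def conjSub (L : Submodule ℂ (GenTangent 𝔥)) : Submodule ℂ (GenTangent 𝔥) := L.comap conjE

theorem mem_conjSub {L : Submodule ℂ (GenTangent 𝔥)} {a : GenTangent 𝔥} :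
    a ∈ conjSub L ↔ conjE a ∈ L := Iff.rfl

end Basic

/-! ## Generalized complex structures -/

/-- An invariant generalized complex structure on `𝔥`, given by its `+i`-eigenspace `L`: a maximal
isotropic subspace with `L ∩ conj L = 0`, closed under the Courant bracket. Maximal isotropy and
transversality are recorded together as: `L` is isotropic and `L ⊕ conj L` is everything. -/
structure GenComplex (𝔥 : Type*) [LieRing 𝔥] [LieAlgebra ℝ 𝔥] where
  /-- the `+i`-eigenspace -/
  L : Submodule ℂ (GenTangent 𝔥)
  isotropic : ∀ a ∈ L, ∀ b ∈ L, pairing a b = 0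
  isCompl : IsCompl L (conjSub L)
  closed : ∀ a ∈ L, ∀ b ∈ L, courant a b ∈ L

/-- The subspace `L` is (the `+i`-eigenspace of) a generalized complex structure. -/
def IsGenComplex {𝔥 : Type*} [LieRing 𝔥] [LieAlgebra ℝ 𝔥]
    (L : Submodule ℂ (GenTangent 𝔥)) : Prop := ∃ 𝒥 : GenComplex 𝔥, 𝒥.L = L

/-- An integrable complex structure: `J² = -1` and the Nijenhuis tensor vanishes. -/
def IsComplexStructure {𝔥 : Type*} [LieRing 𝔥] [LieAlgebra ℝ 𝔥] (J : 𝔥 →ₗ[ℝ] 𝔥) : Prop :=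
  (∀ x, J (J x) = -x) ∧
    ∀ x y, ⁅J x, J y⁆ - J ⁅J x, y⁆ - J ⁅x, J y⁆ - ⁅x, y⁆ = 0

/-- A bilinear form, viewed as a 2-form, is closed for the Chevalley-Eilenberg differential. -/
def IsClosedForm {𝔥 : Type*} [LieRing 𝔥] [LieAlgebra ℝ 𝔥] (Ω : LinearMap.BilinForm ℝ 𝔥) : Prop :=
  ∀ x y z, Ω ⁅x, y⁆ z + Ω ⁅y, z⁆ x + Ω ⁅z, x⁆ y = 0

/-- A symplectic structure on a Lie algebra: a closed non-degenerate 2-form. -/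
structure IsSymplectic {𝔥 : Type*} [LieRing 𝔥] [LieAlgebra ℝ 𝔥]
    (Ω : LinearMap.BilinForm ℝ 𝔥) : Prop where
  isAlt : Ω.IsAlt
  nondegenerate : Ω.Nondegenerate
  closed : IsClosedForm Ω

/-- A pseudo-metric: a non-degenerate symmetric bilinear form. -/
structure IsPseudoMetric {V : Type*} [AddCommGroup V] [Module ℝ V]
    (g : LinearMap.BilinForm ℝ V) : Prop where
  isSymm : g.IsSymm
  nondegenerate : g.Nondegenerate

/-- `(J, Δ)` is a pseudo-Kähler structure: `J` is a complex structure, `Δ` is a `J`-invariant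
pseudo-metric, and the fundamental form `(X, Y) ↦ Δ(JX, Y)` is closed. -/
structure IsPseudoKahler {𝔥 : Type*} [LieRing 𝔥] [LieAlgebra ℝ 𝔥]
    (J : 𝔥 →ₗ[ℝ] 𝔥) (Δ : LinearMap.BilinForm ℝ 𝔥) : Prop where
  isComplex : IsComplexStructure J
  isPseudoMetric : IsPseudoMetric Δ
  invariant : ∀ x y, Δ (J x) (J y) = Δ x y
  closed : IsClosedForm (Δ ∘ₗ J)

section Examples

variable {𝔥 : Type*} [LieRing 𝔥] [LieAlgebra ℝ 𝔥]

/-- The space `𝔥^{1,0}` of `(1,0)`-vectors: the `i`-eigenspace of `J` on `𝔥_ℂ`. -/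
def T10 (J : 𝔥 →ₗ[ℝ] 𝔥) : Submodule ℂ (ℂ ⊗[ℝ] 𝔥) :=
  LinearMap.ker (J.baseChange ℂ - Complex.I • LinearMap.id)

theorem mem_T10 {J : 𝔥 →ₗ[ℝ] 𝔥} {X : ℂ ⊗[ℝ] 𝔥} :
    X ∈ T10 J ↔ J.baseChange ℂ X = Complex.I • X := by
  simp [T10, sub_eq_zero]

theorem baseChange_conjV (J : 𝔥 →ₗ[ℝ] 𝔥) (X : ℂ ⊗[ℝ] 𝔥) :
    J.baseChange ℂ (conjV X) = conjV (J.baseChange ℂ X) := by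
  induction X with
  | zero => simp
  | tmul z v => simp
  | add x y hx hy => simp [hx, hy]

theorem baseChange_sq {J : 𝔥 →ₗ[ℝ] 𝔥} (hJ : ∀ x, J (J x) = -x) (X : ℂ ⊗[ℝ] 𝔥) :
    J.baseChange ℂ (J.baseChange ℂ X) = -X := by
  induction X with
  | zero => simp
  | tmul z v => simp [hJ, TensorProduct.tmul_neg]
  | add x y hx hy => simp [hx, hy]; abel

theorem nijenhuis_baseChange {J : 𝔥 →ₗ[ℝ] 𝔥} (hJ : IsComplexStructure J) (X Y : ℂ ⊗[ℝ] 𝔥) :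
    ⁅J.baseChange ℂ X, J.baseChange ℂ Y⁆ - J.baseChange ℂ ⁅J.baseChange ℂ X, Y⁆
      - J.baseChange ℂ ⁅X, J.baseChange ℂ Y⁆ - ⁅X, Y⁆ = 0 := by
  induction X with
  | zero => simp
  | add x x' hx hx' =>
    simp only [map_add, cx_add_lie]
    calc _ = _ := ?_
      _ = (0 : ℂ ⊗[ℝ] 𝔥) + 0 := congrArg₂ (· + ·) hx hx'
      _ = 0 := add_zero 0
    abel
  | tmul z v =>
    induction Y with
    | zero => simp [cx_lie_zero]
    | add y y' hy hy' =>
      simp only [map_add, cx_lie_add]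
      calc _ = _ := ?_
        _ = (0 : ℂ ⊗[ℝ] 𝔥) + 0 := congrArg₂ (· + ·) hy hy'
        _ = 0 := add_zero 0
      abel
    | tmul w u =>
      simp only [LinearMap.baseChange_tmul, LieAlgebra.ExtendScalars.bracket_tmul,
        ← TensorProduct.tmul_sub, hJ.2 v u, TensorProduct.tmul_zero]

/-- The generalized complex structure of a classical complex structure,
`L = 𝔥^{1,0} ⊕ 𝔥^{*(0,1)}`, where the `(0,1)`-forms are the forms that vanish on `𝔥^{1,0}`. -/
def ofComplex (J : 𝔥 →ₗ[ℝ] 𝔥) (hJ : IsComplexStructure J) : GenComplex 𝔥 where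
  L := (T10 J).prod (T10 J).dualAnnihilator
  isotropic a ha b hb := by
    have h1 : a.2 b.1 = 0 := (Submodule.mem_dualAnnihilator _).1 ha.2 _ hb.1
    have h2 : b.2 a.1 = 0 := (Submodule.mem_dualAnnihilator _).1 hb.2 _ ha.1
    simp [pairing, h1, h2]
  isCompl := by
    set Jc := J.baseChange ℂ with hJc
    have hP : ∀ X : ℂ ⊗[ℝ] 𝔥, (1 / 2 : ℂ) • (X - Complex.I • Jc X) ∈ T10 J := by
      intro X
      rw [mem_T10, ← hJc]
      simp only [map_smul, map_sub, baseChange_sq hJ.1 X, hJc]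
      rw [smul_comm Complex.I (1 / 2 : ℂ)]
      congr 1
      rw [smul_sub, smul_smul, Complex.I_mul_I]
      simp only [smul_neg, neg_smul, one_smul]
      abel
    have hQ : ∀ X : ℂ ⊗[ℝ] 𝔥, conjV ((1 / 2 : ℂ) • (X + Complex.I • Jc X)) ∈ T10 J := by
      intro X
      have : conjV ((1 / 2 : ℂ) • (X + Complex.I • Jc X))
          = (1 / 2 : ℂ) • (conjV X - Complex.I • Jc (conjV X)) := by
        rw [hJc, baseChange_conjV]
        simp only [map_smulₛₗ, map_add, Complex.conj_I, map_div₀, map_one, map_ofNat, neg_smul,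
          sub_eq_add_neg]
      rw [this]; exact hP _
    have hPQ : ∀ X : ℂ ⊗[ℝ] 𝔥,
        X = (1 / 2 : ℂ) • (X - Complex.I • Jc X) + (1 / 2 : ℂ) • (X + Complex.I • Jc X) := by
      intro X; module
    constructor
    · rw [Submodule.disjoint_def]
      rintro ⟨X, α⟩ ⟨hX, hα⟩ ⟨hX', hα'⟩
      simp only [conjE_apply] at hX hα hX' hα'
      have hα1 := (Submodule.mem_dualAnnihilator _).1 hα
      have hα2 := (Submodule.mem_dualAnnihilator _).1 hα'
      ext1
      · have h1 := mem_T10.1 hX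
        have h2 := mem_T10.1 hX'
        rw [baseChange_conjV, h1] at h2
        have h3 := congrArg conjV h2
        simp only [map_smulₛₗ, conjV_conjV, Complex.conj_I] at h3
        have h4 : (2 * Complex.I) • X = 0 := by
          have : (2 * Complex.I) • X = Complex.I • X - (-Complex.I) • X := by module
          rw [this, ← h3]; simp
        exact (smul_eq_zero.1 h4).resolve_left (by simp)
      · show α = 0
        refine LinearMap.ext fun X => ?_
        rw [hPQ X, map_add, hα1 _ (hP X)]
        have := hα2 _ (hQ X)
        rw [conjD_apply, conjV_conjV] at this
        have h0 := congrArg (starRingEnd ℂ) this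
        simp only [RingHomCompTriple.comp_apply, RingHom.id_apply, map_zero] at h0
        rw [h0]; simp
    · rw [codisjoint_iff, eq_top_iff]
      rintro ⟨X, α⟩ -
      let P : (ℂ ⊗[ℝ] 𝔥) →ₗ[ℂ] (ℂ ⊗[ℝ] 𝔥) := (1 / 2 : ℂ) • (LinearMap.id - Complex.I • Jc)
      let Q : (ℂ ⊗[ℝ] 𝔥) →ₗ[ℂ] (ℂ ⊗[ℝ] 𝔥) := (1 / 2 : ℂ) • (LinearMap.id + Complex.I • Jc)
      refine Submodule.mem_sup.2 ⟨(P X, α ∘ₗ Q), ⟨hP X, ?_⟩, (Q X, α ∘ₗ P), ⟨hQ X, ?_⟩, ?_⟩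
      · refine (Submodule.mem_dualAnnihilator _).2 fun Y hY => ?_
        have h1 := mem_T10.1 hY
        have : Q Y = 0 := by
          simp only [Q, LinearMap.smul_apply, LinearMap.add_apply, LinearMap.id_apply, hJc, h1,
            smul_smul, Complex.I_mul_I]
          simp
        simp [this]
      · refine (Submodule.mem_dualAnnihilator _).2 fun Y hY => ?_
        have h1 := mem_T10.1 hY
        have : P (conjV Y) = 0 := by
          simp only [P, LinearMap.smul_apply, LinearMap.sub_apply, LinearMap.id_apply, hJc,
            baseChange_conjV, h1, map_smulₛₗ, Complex.conj_I, smul_smul]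
          simp
        simp [conjE_apply, conjD_apply, this]
      · ext1
        · exact (hPQ X).symm
        · refine LinearMap.ext fun Y => ?_
          show α (Q Y) + α (P Y) = α Y
          rw [← map_add, add_comm]
          exact congrArg α (hPQ Y).symm
  closed a ha b hb := by
    have cl : ∀ X ∈ T10 J, ∀ Y ∈ T10 J, ⁅X, Y⁆ ∈ T10 J := by
      intro X hX Y hY
      have h := nijenhuis_baseChange hJ X Y
      rw [mem_T10.1 hX, mem_T10.1 hY] at h
      rw [mem_T10]
      simp only [cx_smul_lie, cx_lie_smul, map_smul, smul_smul, Complex.I_mul_I] at h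
      have h2 : (2 * Complex.I) • (J.baseChange ℂ ⁅X, Y⁆ - Complex.I • ⁅X, Y⁆) = 0 := by
        rw [← neg_eq_zero, ← h, smul_sub, smul_smul, mul_assoc, Complex.I_mul_I]
        module
      exact sub_eq_zero.1 ((smul_eq_zero.1 h2).resolve_left (by simp))
    refine ⟨cl _ ha.1 _ hb.1, (Submodule.mem_dualAnnihilator _).2 fun Y hY => ?_⟩
    have h1 := (Submodule.mem_dualAnnihilator _).1 ha.2 _ (cl _ hb.1 _ hY)
    have h2 := (Submodule.mem_dualAnnihilator _).1 hb.2 _ (cl _ ha.1 _ hY)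
    simp [courant, lieDer_apply, h1, h2]

theorem baseChange_alt {Ω : LinearMap.BilinForm ℝ 𝔥} (h : Ω.IsAlt) (X Y : ℂ ⊗[ℝ] 𝔥) :
    Ω.baseChange ℂ X Y = -Ω.baseChange ℂ Y X := by
  induction X with
  | zero => simp
  | add x x' hx hx' => simp [hx, hx']; ring
  | tmul z v =>
    induction Y with
    | zero => simp
    | add y y' hy hy' => simp only [map_add, LinearMap.add_apply, hy, hy']; ring
    | tmul w u =>
      have : Ω u v = -Ω v u := (LinearMap.BilinForm.IsAlt.neg_eq h v u).symm
      simp [this, mul_comm]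

theorem baseChange_closed {Ω : LinearMap.BilinForm ℝ 𝔥} (h : IsClosedForm Ω)
    (X Y Z : ℂ ⊗[ℝ] 𝔥) :
    Ω.baseChange ℂ ⁅X, Y⁆ Z + Ω.baseChange ℂ ⁅Y, Z⁆ X + Ω.baseChange ℂ ⁅Z, X⁆ Y = 0 := by
  induction X with
  | zero => simp [cx_lie_zero]
  | add x x' hx hx' =>
    simp only [map_add, cx_add_lie, cx_lie_add, LinearMap.add_apply]
    linear_combination hx + hx'
  | tmul z v =>
    induction Y with
    | zero => simp [cx_lie_zero]
    | add y y' hy hy' =>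
      simp only [map_add, cx_add_lie, cx_lie_add, LinearMap.add_apply]
      linear_combination hy + hy'
    | tmul w u =>
      induction Z with
      | zero => simp [cx_lie_zero]
      | add y y' hy hy' =>
        simp only [map_add, cx_add_lie, cx_lie_add, LinearMap.add_apply]
        linear_combination hy + hy'
      | tmul s t =>
        have := congrArg (Complex.ofReal) (h v u t)
        simp only [LieAlgebra.ExtendScalars.bracket_tmul, LinearMap.BilinForm.baseChange_tmul,
          Complex.real_smul]
        push_cast at this
        linear_combination (z * w * s) * this

theorem baseChange_conj (Ω : LinearMap.BilinForm ℝ 𝔥) (X Y : ℂ ⊗[ℝ] 𝔥) :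
    Ω.baseChange ℂ (conjV X) (conjV Y) = starRingEnd ℂ (Ω.baseChange ℂ X Y) := by
  induction X with
  | zero => simp
  | add x x' hx hx' => simp [hx, hx']
  | tmul z v =>
    induction Y with
    | zero => simp
    | add y y' hy hy' => simp only [map_add, hy, hy']
    | tmul w u => simp

theorem exists_re_im (X : ℂ ⊗[ℝ] 𝔥) :
    ∃ x y : 𝔥, X = (1 : ℂ) ⊗ₜ[ℝ] x + Complex.I ⊗ₜ[ℝ] y := by
  induction X with
  | zero => exact ⟨0, 0, by simp⟩
  | add X Y hX hY =>
    obtain ⟨x, y, rfl⟩ := hX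
    obtain ⟨x', y', rfl⟩ := hY
    exact ⟨x + x', y + y', by simp only [TensorProduct.tmul_add]; abel⟩
  | tmul z v =>
    refine ⟨z.re • v, z.im • v, ?_⟩
    rw [← TensorProduct.smul_tmul, ← TensorProduct.smul_tmul, ← TensorProduct.add_tmul]
    congr 1
    apply Complex.ext <;> simp

theorem baseChange_injective {Ω : LinearMap.BilinForm ℝ 𝔥} (h : Ω.Nondegenerate) :
    Function.Injective (Ω.baseChange ℂ) := by
  rw [injective_iff_map_eq_zero]
  intro X hX
  obtain ⟨x, y, rfl⟩ := exists_re_im X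
  have hz : ∀ z, Ω x z = 0 ∧ Ω y z = 0 := by
    intro z
    have := LinearMap.congr_fun hX ((1 : ℂ) ⊗ₜ[ℝ] z)
    simp only [map_add, LinearMap.add_apply, LinearMap.BilinForm.baseChange_tmul,
      Complex.real_smul, LinearMap.zero_apply] at this
    have h1 := congrArg Complex.re this
    have h2 := congrArg Complex.im this
    simp at h1 h2
    exact ⟨h1, h2⟩
  have hx : x = 0 := h.1 x fun z => (hz z).1
  have hy : y = 0 := h.1 y fun z => (hz z).2
  simp [hx, hy]

/-- The generalized complex structure of a symplectic form, `L = {X - i ι_X Ω}`. -/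
def ofSymplectic [FiniteDimensional ℝ 𝔥] (Ω : LinearMap.BilinForm ℝ 𝔥) (hΩ : IsSymplectic Ω) :
    GenComplex 𝔥 where
  L := LinearMap.range
    (LinearMap.prod (LinearMap.id : (ℂ ⊗[ℝ] 𝔥) →ₗ[ℂ] (ℂ ⊗[ℝ] 𝔥))
      (-(Complex.I • Ω.baseChange ℂ)))
  isotropic := by
    rintro _ ⟨X, rfl⟩ _ ⟨Y, rfl⟩
    simp [pairing, baseChange_alt hΩ.isAlt X Y]
  isCompl := by
    have hinj := baseChange_injective hΩ.nondegenerate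
    have hsurj : Function.Surjective (Ω.baseChange ℂ) :=
      (LinearMap.injective_iff_surjective_of_finrank_eq_finrank
        (Subspace.dual_finrank_eq).symm).1 hinj
    constructor
    · rw [Submodule.disjoint_def]
      rintro _ ⟨X, rfl⟩ ⟨Y, hY⟩
      have h1 : Y = conjV X := congrArg Prod.fst hY
      have h2 := congrArg Prod.snd hY
      have hX : Ω.baseChange ℂ X = 0 := by
        refine LinearMap.ext fun Z => ?_
        have := LinearMap.congr_fun h2 (conjV Z)
        simp only [h1, LinearMap.prod_apply, Function.prod, conjE_apply, conjD_apply, conjV_conjV,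
          LinearMap.neg_apply, LinearMap.smul_apply, baseChange_conj, smul_eq_mul, map_neg,
          map_mul, Complex.conj_I] at this
        have h3 : Complex.I * starRingEnd ℂ (Ω.baseChange ℂ X Z) = 0 := by
          linear_combination (-1 / 2 : ℂ) * this
        have h4 := (mul_eq_zero.1 h3).resolve_left Complex.I_ne_zero
        simpa using h4
      have : X = 0 := hinj (by rw [hX, map_zero])
      simp [this]
    · rw [codisjoint_iff, eq_top_iff]
      rintro ⟨X, α⟩ -
      obtain ⟨W, rfl⟩ := hsurj α
      have hA : ∀ A : ℂ ⊗[ℝ] 𝔥, ((A, Complex.I • Ω.baseChange ℂ A) : GenTangent 𝔥) ∈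
          conjSub (LinearMap.range
            (LinearMap.prod (LinearMap.id : (ℂ ⊗[ℝ] 𝔥) →ₗ[ℂ] (ℂ ⊗[ℝ] 𝔥))
              (-(Complex.I • Ω.baseChange ℂ)))) := by
        intro A
        refine ⟨conjV A, ?_⟩
        ext1
        · rfl
        · refine LinearMap.ext fun Z => ?_
          have := baseChange_conj Ω A (conjV Z)
          rw [conjV_conjV] at this
          simp [conjE_apply, conjD_apply, this]
      refine Submodule.mem_sup.2 ⟨_, ⟨(1 / 2 : ℂ) • (X + Complex.I • W), rfl⟩, _,
        hA ((1 / 2 : ℂ) • (X - Complex.I • W)), ?_⟩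
      ext1
      · simp only [LinearMap.prod_apply, Function.prod, LinearMap.id_apply, Prod.mk_add_mk]
        module
      · refine LinearMap.ext fun Z => ?_
        show -(Complex.I * Ω.baseChange ℂ ((1 / 2 : ℂ) • (X + Complex.I • W)) Z)
          + Complex.I * Ω.baseChange ℂ ((1 / 2 : ℂ) • (X - Complex.I • W)) Z
          = Ω.baseChange ℂ W Z
        simp only [LinearMap.smul_apply, map_smul, map_add, map_sub, LinearMap.add_apply,
          LinearMap.sub_apply, smul_eq_mul]
        linear_combination (-(Ω.baseChange ℂ W Z)) * Complex.I_mul_I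
  closed := by
    rintro _ ⟨X, rfl⟩ _ ⟨Y, rfl⟩
    refine ⟨⁅X, Y⁆, ?_⟩
    ext1
    · rfl
    · refine LinearMap.ext fun Z => ?_
      have h := baseChange_closed hΩ.closed X Y Z
      have h1 := baseChange_alt hΩ.isAlt ⁅Y, Z⁆ X
      have h2 := baseChange_alt hΩ.isAlt ⁅X, Z⁆ Y
      have h3 : Ω.baseChange ℂ ⁅Z, X⁆ Y = -Ω.baseChange ℂ ⁅X, Z⁆ Y := by
        rw [cx_lie_skew Z X, map_neg, LinearMap.neg_apply]
      simp only [courant, LinearMap.prod_apply, Function.prod, LinearMap.neg_apply,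
        LinearMap.smul_apply, LinearMap.id_apply, LinearMap.sub_apply, lieDer_apply, smul_eq_mul]
      linear_combination (-Complex.I) * (h - h1 - h3 + h2)

/-- The `B`-field transformation `X + α ↦ X + α + ι_X B` by a real 2-form `B`. -/
def bField (B : LinearMap.BilinForm ℝ 𝔥) : GenTangent 𝔥 →ₗ[ℂ] GenTangent 𝔥 :=
  LinearMap.id + LinearMap.inr ℂ _ _ ∘ₗ (B.baseChange ℂ) ∘ₗ LinearMap.fst ℂ _ _

end Examples

/-! ## The differential Gerstenhaber algebra -/

namespace GenComplex

variable {𝔥 : Type*} [LieRing 𝔥] [LieAlgebra ℝ 𝔥] (𝒥 : GenComplex 𝔥)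

/-- The Courant bracket restricted to `L`. -/
def bracketL (x y : 𝒥.L) : 𝒥.L := ⟨courant (x : GenTangent 𝔥) y, 𝒥.closed _ x.2 _ y.2⟩

/-- The functional `ℓ ↦ σ(a)(ℓ) = 2 ⟨a, ℓ⟩` on `L` defined by a generalized tangent vector `a`. -/
def restrictL : GenTangent 𝔥 →ₗ[ℂ] Module.Dual ℂ 𝒥.L :=
  (Submodule.subtype 𝒥.L).dualMap ∘ₗ sigma

theorem restrictL_apply (a : GenTangent 𝔥) (x : 𝒥.L) :
    𝒥.restrictL a x = sigma a (x : GenTangent 𝔥) := rfl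

theorem sigma_conj (a b : GenTangent 𝔥) :
    sigma (conjE a) (conjE b) = starRingEnd ℂ (sigma a b) := by
  simp [sigma_apply, conjE_apply, conjD_apply]

theorem sigma_eq_zero {a : GenTangent 𝔥} (h : ∀ b, sigma a b = 0) : a = 0 := by
  ext1
  · exact (Module.forall_dual_apply_eq_zero_iff ℂ a.1).1 fun β => by
      simpa [sigma_apply] using h (0, β)
  · exact LinearMap.ext fun Y => by simpa [sigma_apply] using h (Y, 0)

theorem sigma_conjSub {a b : GenTangent 𝔥} (ha : a ∈ conjSub 𝒥.L) (hb : b ∈ conjSub 𝒥.L) :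
    sigma a b = 0 := by
  have h := sigma_conj a b
  rw [sigma_eq_two_pairing, 𝒥.isotropic _ ha _ hb, mul_zero] at h
  simpa using h.symm

theorem sigma_L {a b : GenTangent 𝔥} (ha : a ∈ 𝒥.L) (hb : b ∈ 𝒥.L) : sigma a b = 0 := by
  rw [sigma_eq_two_pairing, 𝒥.isotropic _ ha _ hb, mul_zero]

variable [FiniteDimensional ℝ 𝔥]

theorem sigma_surjective (F : Module.Dual ℂ (GenTangent 𝔥)) : ∃ a, sigma a = F := by
  refine ⟨((Module.evalEquiv ℂ (ℂ ⊗[ℝ] 𝔥)).symm (F ∘ₗ LinearMap.inr ℂ _ _),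
    F ∘ₗ LinearMap.inl ℂ _ _), LinearMap.ext fun b => ?_⟩
  rw [sigma_apply, Module.apply_evalEquiv_symm_apply]
  simp only [LinearMap.comp_apply, LinearMap.inl_apply, LinearMap.inr_apply]
  rw [← map_add]
  simp

theorem restrictL_bijective :
    Function.Bijective (𝒥.restrictL ∘ₗ (conjSub 𝒥.L).subtype) := by
  constructor
  · rw [injective_iff_map_eq_zero]
    intro m hm
    refine Subtype.ext (sigma_eq_zero fun b => ?_)
    obtain ⟨x, hx, y, hy, rfl⟩ := Submodule.mem_sup.1
      (𝒥.isCompl.sup_eq_top ▸ Submodule.mem_top : b ∈ 𝒥.L ⊔ conjSub 𝒥.L)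
    have h1 := LinearMap.congr_fun hm ⟨x, hx⟩
    rw [map_add, 𝒥.sigma_conjSub m.2 hy, add_zero]
    exact h1
  · intro f
    obtain ⟨a, ha⟩ := sigma_surjective (f ∘ₗ Submodule.projectionOnto _ _ 𝒥.isCompl)
    obtain ⟨x, hx, y, hy, rfl⟩ := Submodule.mem_sup.1
      (𝒥.isCompl.sup_eq_top ▸ Submodule.mem_top : a ∈ 𝒥.L ⊔ conjSub 𝒥.L)
    refine ⟨⟨y, hy⟩, LinearMap.ext fun z => ?_⟩
    have h := LinearMap.congr_fun ha (z : GenTangent 𝔥)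
    rw [map_add, LinearMap.add_apply, 𝒥.sigma_L hx z.2, zero_add] at h
    have hz : sigma y (z : GenTangent 𝔥) = f z := by simpa using h
    exact hz

/-- The identification of `conj L` with the dual of `L` given by `σ`. -/
def conjEquivDual : conjSub 𝒥.L ≃ₗ[ℂ] Module.Dual ℂ 𝒥.L :=
  LinearEquiv.ofBijective (𝒥.restrictL ∘ₗ (conjSub 𝒥.L).subtype) 𝒥.restrictL_bijective

/-- The Schouten bracket on `⋀ L`. On decomposable elements it is
`⟦x₁ ∧ ⋯ ∧ xₚ, y₁ ∧ ⋯ ∧ y_q⟧ =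
  ∑ₖₗ (-1)^(k+l) ⟦xₖ, yₗ⟧ ∧ x₁ ∧ ⋯ x̂ₖ ⋯ ∧ xₚ ∧ y₁ ∧ ⋯ ŷₗ ⋯ ∧ y_q`; it is written here
with a basis `e` of `L` and its dual basis `e^*` as
`⟦A, B⟧ = ∑ᵢⱼ (A ⌊ eᵢ^*) ∧ ⟦eᵢ, eⱼ⟧ ∧ (eⱼ^* ⌋ B)`, which does not depend on the basis. -/
def schouten (A B : ExteriorAlgebra ℂ 𝒥.L) : ExteriorAlgebra ℂ 𝒥.L :=
  let e := Module.finBasis ℂ 𝒥.L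
  ∑ i, ∑ j, CliffordAlgebra.contractRight A (e.coord i) *
    ExteriorAlgebra.ι ℂ (𝒥.bracketL (e i) (e j)) * CliffordAlgebra.contractLeft (e.coord j) B

/-- The Lie algebroid differential `∂̄ : ⋀ⁿ L → ⋀ⁿ⁺¹ L` of `conj L`, that is, the
Chevalley-Eilenberg differential of the Lie algebra `conj L` under `L ≅ (conj L)^*`. With a basis
`e` of `L` and the dual basis `m` of `conj L` it is
`∂̄ A = -(1/2) ∑ᵢⱼ eᵢ ∧ eⱼ ∧ (⟦mᵢ, mⱼ⟧ ⌋ A)`, which does not depend on the basis. It is the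
odd derivation with `(∂̄ ℓ)(m, m') = -ℓ(⟦m, m'⟧)` for `ℓ ∈ L` and `m, m' ∈ conj L`. -/
def dbar (A : ExteriorAlgebra ℂ 𝒥.L) : ExteriorAlgebra ℂ 𝒥.L :=
  let e := Module.finBasis ℂ 𝒥.L
  let m : _ → GenTangent 𝔥 := fun i => (𝒥.conjEquivDual.symm (e.coord i) : GenTangent 𝔥)
  (-(1 / 2) : ℂ) • ∑ i, ∑ j, ExteriorAlgebra.ι ℂ (e i) * ExteriorAlgebra.ι ℂ (e j) *
    CliffordAlgebra.contractLeft (𝒥.restrictL (courant (m i) (m j))) A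

/-- An element `Γ` of `⋀² L`, viewed by contraction as a map `conj L → L`. -/
def contraction (Γ : ExteriorAlgebra ℂ 𝒥.L) : conjSub 𝒥.L →ₗ[ℂ] 𝒥.L :=
  ExteriorAlgebra.ιInv ∘ₗ (CliffordAlgebra.contractLeft (Q := (0 : QuadraticForm ℂ 𝒥.L))).flip Γ ∘ₗ
    𝒥.conjEquivDual.toLinearMap

/-- The deformation of `conj L` along `Γ ∈ ⋀² L`: the graph `{m + Γ(m) : m ∈ conj L}`. -/
def deformConj (Γ : ExteriorAlgebra ℂ 𝒥.L) : Submodule ℂ (GenTangent 𝔥) :=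
  LinearMap.range ((conjSub 𝒥.L).subtype + 𝒥.L.subtype ∘ₗ 𝒥.contraction Γ)

/-- The deformation of `L` along `Γ ∈ ⋀² L`: the space `{ℓ + conj(Γ)(ℓ) : ℓ ∈ L}`, which is the
conjugate of `{m + Γ(m) : m ∈ conj L}`. -/
def deform (Γ : ExteriorAlgebra ℂ 𝒥.L) : Submodule ℂ (GenTangent 𝔥) := conjSub (𝒥.deformConj Γ)

/-- An isomorphism between the differential Gerstenhaber algebras
`DGA = (⋀ L, ⟦-, -⟧, ∧, ∂̄)` of two generalized complex structures: a degree preserving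
isomorphism of exterior algebras that respects the Schouten brackets and the differentials. -/
structure DGAEquiv {𝔥' : Type*} [LieRing 𝔥'] [LieAlgebra ℝ 𝔥'] [FiniteDimensional ℝ 𝔥']
    (𝒥₁ : GenComplex 𝔥) (𝒥₂ : GenComplex 𝔥') where
  /-- the underlying isomorphism of exterior algebras -/
  toAlgEquiv : ExteriorAlgebra ℂ 𝒥₁.L ≃ₐ[ℂ] ExteriorAlgebra ℂ 𝒥₂.L
  map_degree : ∀ (n : ℕ) (A : ExteriorAlgebra ℂ 𝒥₁.L),
    A ∈ ⋀[ℂ]^n 𝒥₁.L → toAlgEquiv A ∈ ⋀[ℂ]^n 𝒥₂.L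
  map_schouten : ∀ A B, toAlgEquiv (𝒥₁.schouten A B) =
    𝒥₂.schouten (toAlgEquiv A) (toAlgEquiv B)
  map_dbar : ∀ A, toAlgEquiv (𝒥₁.dbar A) = 𝒥₂.dbar (toAlgEquiv A)

end GenComplex

/-! ## The semi-direct product `𝔤 ⋉_γ V` -/

/-- A flat connection on `𝔤`: a linear map `γ : 𝔤 → End(V)`, where `V` is the underlying vector
space of `𝔤`, that is a representation: `γ([x, y]) = γ(x) γ(y) - γ(y) γ(x)`. -/
structure FlatConnection (𝔤 : Type*) [LieRing 𝔤] [LieAlgebra ℝ 𝔤] where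
  /-- the linear map `γ` -/
  toLinearMap : 𝔤 →ₗ[ℝ] Module.End ℝ 𝔤
  flat : ∀ x y, toLinearMap ⁅x, y⁆ =
    toLinearMap x * toLinearMap y - toLinearMap y * toLinearMap x

instance {𝔤 : Type*} [LieRing 𝔤] [LieAlgebra ℝ 𝔤] :
    CoeFun (FlatConnection 𝔤) (fun _ => 𝔤 → Module.End ℝ 𝔤) := ⟨fun γ => γ.toLinearMap⟩

section SemiDirect

variable {𝔤 : Type*} [LieRing 𝔤] [LieAlgebra ℝ 𝔤]

/-- The underlying vector space `𝔤 ⊕ V` of the semi-direct product `𝔤 ⋉_γ V`, where `V` is the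
underlying vector space of `𝔤` and `γ` is a flat connection. -/
def SemiProd (_γ : FlatConnection 𝔤) : Type _ := 𝔤 × 𝔤

variable (γ : FlatConnection 𝔤)

/-- The connection `γ` is torsion-free. -/
def IsTorsionFree : Prop := ∀ x y, γ x y - γ y x = ⁅x, y⁆

/-- The connection `γ` is symplectic with respect to `ω`. -/
def IsSymplecticConnection (ω : LinearMap.BilinForm ℝ 𝔤) : Prop :=
  ∀ x y z, ω (γ x y) z + ω y (γ x z) = 0

instance : AddCommGroup (SemiProd γ) := inferInstanceAs (AddCommGroup (𝔤 × 𝔤))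

instance : Module ℝ (SemiProd γ) := inferInstanceAs (Module ℝ (𝔤 × 𝔤))

instance [FiniteDimensional ℝ 𝔤] : FiniteDimensional ℝ (SemiProd γ) :=
  inferInstanceAs (FiniteDimensional ℝ (𝔤 × 𝔤))

namespace SemiProd

/-- The first projection. -/
def fst : SemiProd γ →ₗ[ℝ] 𝔤 := LinearMap.fst ℝ 𝔤 𝔤

/-- The second projection. -/
def snd : SemiProd γ →ₗ[ℝ] 𝔤 := LinearMap.snd ℝ 𝔤 𝔤

/-- The pair `(x, u)` with `x ∈ 𝔤` and `u ∈ V`. -/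
def mk (x u : 𝔤) : SemiProd γ := (x, u)

@[simp] theorem fst_mk (x u : 𝔤) : fst γ (mk γ x u) = x := rfl

@[simp] theorem snd_mk (x u : 𝔤) : snd γ (mk γ x u) = u := rfl

variable {γ} in
theorem ext' {a b : SemiProd γ} (h₁ : fst γ a = fst γ b) (h₂ : snd γ a = snd γ b) : a = b :=
  Prod.ext h₁ h₂

/-- The bracket `[(x, u), (y, v)] = ([x, y], γ(x) v - γ(y) u)`. -/
instance : Bracket (SemiProd γ) (SemiProd γ) where
  bracket a b := mk γ ⁅fst γ a, fst γ b⁆ (γ (fst γ a) (snd γ b) - γ (fst γ b) (snd γ a))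

@[simp] theorem fst_lie (a b : SemiProd γ) : fst γ ⁅a, b⁆ = ⁅fst γ a, fst γ b⁆ := rfl

@[simp] theorem snd_lie (a b : SemiProd γ) :
    snd γ ⁅a, b⁆ = γ (fst γ a) (snd γ b) - γ (fst γ b) (snd γ a) := rfl

instance : LieRing (SemiProd γ) where
  add_lie a b c := by
    refine ext' ?_ ?_
    · simp
    · simp; abel
  lie_add a b c := by
    refine ext' ?_ ?_
    · simp
    · simp; abel
  lie_self a := by
    refine ext' ?_ ?_ <;> simp
  leibniz_lie a b c := by
    refine ext' ?_ ?_
    · simp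
    · simp [γ.flat]; abel

instance : LieAlgebra ℝ (SemiProd γ) where
  lie_smul t a b := by
    refine ext' ?_ ?_
    · simp
    · simp [smul_sub]

/-- The complex structure `J(x, u) = (-u, x)`. -/
def J : SemiProd γ →ₗ[ℝ] SemiProd γ :=
  LinearMap.prod (-(LinearMap.snd ℝ 𝔤 𝔤)) (LinearMap.fst ℝ 𝔤 𝔤)

theorem J_mk (x u : 𝔤) : J γ (mk γ x u) = mk γ (-u) x := rfl

/-- `Ω₁((x, u), (y, v)) = -ω(x, v) - ω(u, y)`. -/
def Ω₁ (ω : LinearMap.BilinForm ℝ 𝔤) : LinearMap.BilinForm ℝ (SemiProd γ) :=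
  -(ω.compl₁₂ (fst γ) (snd γ)) - ω.compl₁₂ (snd γ) (fst γ)

theorem Ω₁_mk (ω : LinearMap.BilinForm ℝ 𝔤) (x u y v : 𝔤) :
    Ω₁ γ ω (mk γ x u) (mk γ y v) = -ω x v - ω u y := rfl

/-- `Ω₂((x, u), (y, v)) = ω(x, y) - ω(u, v)`. -/
def Ω₂ (ω : LinearMap.BilinForm ℝ 𝔤) : LinearMap.BilinForm ℝ (SemiProd γ) :=
  ω.compl₁₂ (fst γ) (fst γ) - ω.compl₁₂ (snd γ) (snd γ)

theorem Ω₂_mk (ω : LinearMap.BilinForm ℝ 𝔤) (x u y v : 𝔤) :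
    Ω₂ γ ω (mk γ x u) (mk γ y v) = ω x y - ω u v := rfl

/-- `Ω₃((x, u), (y, v)) = ω(x, y) + ω(u, v)`. -/
def Ω₃ (ω : LinearMap.BilinForm ℝ 𝔤) : LinearMap.BilinForm ℝ (SemiProd γ) :=
  ω.compl₁₂ (fst γ) (fst γ) + ω.compl₁₂ (snd γ) (snd γ)

theorem Ω₃_mk (ω : LinearMap.BilinForm ℝ 𝔤) (x u y v : 𝔤) :
    Ω₃ γ ω (mk γ x u) (mk γ y v) = ω x y + ω u v := rfl

/-- `Δ((x, u), (y, v)) = g(x, y) + g(u, v)`. -/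
def Δ (g : LinearMap.BilinForm ℝ 𝔤) : LinearMap.BilinForm ℝ (SemiProd γ) :=
  g.compl₁₂ (fst γ) (fst γ) + g.compl₁₂ (snd γ) (snd γ)

theorem Δ_mk (g : LinearMap.BilinForm ℝ 𝔤) (x u y v : 𝔤) :
    Δ γ g (mk γ x u) (mk γ y v) = g x y + g u v := rfl

end SemiProd

/-- The endomorphism `g⁻¹ω` of `V`, where `g` and `ω` are viewed as the maps `a ↦ g(a, -)` and
`a ↦ ω(a, -)` from `V` to `V^*`. -/
def invComp [FiniteDimensional ℝ 𝔤] (g : LinearMap.BilinForm ℝ 𝔤) (hg : g.Nondegenerate)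
    (ω : LinearMap.BilinForm ℝ 𝔤) : 𝔤 →ₗ[ℝ] 𝔤 :=
  (LinearMap.BilinForm.toDual g hg).symm.toLinearMap ∘ₗ ω

end SemiDirect

end

end GenGeom

/-!
Since `Ω₁ = Ω₂ ∘ J`, the bivector `Ω₂⁻¹` has type `(2,0) + (0,2)`, and the `(2,0)`-part of
`-(i/2) Ω₂⁻¹` is an element `Λ` of `⋀² L_J`. For `t ≠ 0` the deformation of `L_J` along `t Λ` is
the graph of `t⁻¹ (Ω₁ - i Ω₂)`, that is, the transform of `L_{t⁻¹Ω₂}` by the `B`-field `t⁻¹ Ω₁`.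

The differential Gerstenhaber algebra of `L` depends only on the Lie algebra `L` and its Hermitian
form `2 ⟨-, conj -⟩`, because that form identifies the dual of `L` with `conj L`. Both `L_J` and
`L_{Ω₂}` are `𝔥_ℂ` as Lie algebras, with the Hermitian forms `2i Ω₁(conj X, Y)` and
`2i Ω₂(conj X, Y)`, so it is enough to carry `Ω₂` to `Ω₁` by an automorphism of `𝔥`. With
`T = g⁻¹ω`, the hypotheses make `D = J ∘ (1 - T)` a derivation of `𝔥` that acts on the complex form
`Ω₂ - i Ω₁` as multiplication by `2i`, and `exp (π/4 D)` is the automorphism sought.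
-/

namespace GenGeom

noncomputable section

section Exponential

open NormedSpace

theorem exp_mul_exp_neg {𝔸 : Type*} [NormedRing 𝔸] [NormedAlgebra ℝ 𝔸] [CompleteSpace 𝔸] (a : 𝔸) :
    exp a * exp (-a) = 1 := by
  let _ : NormedAlgebra ℚ 𝔸 := NormedAlgebra.restrictScalars ℚ ℝ 𝔸
  rw [← exp_add_of_commute (Commute.refl a).neg_right, add_neg_cancel, exp_zero]

theorem exp_apply_bilin_of_derivation {E F : Type*} [NormedAddCommGroup E] [NormedSpace ℝ E]
    [CompleteSpace E] [NormedAddCommGroup F] [NormedSpace ℝ F] [CompleteSpace F]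
    (β : E →L[ℝ] E →L[ℝ] F) {D : E →L[ℝ] E} {D' : F →L[ℝ] F}
    (h : ∀ x y, D' (β x y) = β (D x) y + β x (D y)) (x y : E) :
    β (exp D x) (exp D y) = exp D' (β x y) := by
  have deriv_flow (z : E) (t : ℝ) :
      HasDerivAt (fun s : ℝ => exp (s • D) z) (D (exp (t • D) z)) t := by
    simpa using (hasDerivAt_exp_smul_const' D t).clm_apply (hasDerivAt_const t z)
  have deriv_zero (t : ℝ) : HasDerivAt
      (fun s : ℝ => exp (s • -D') (β (exp (s • D) x) (exp (s • D) y))) 0 t := by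
    have hβ := (β.hasFDerivAt.comp_hasDerivAt t (deriv_flow x t)).clm_apply (deriv_flow y t)
    simpa [← h] using (hasDerivAt_exp_smul_const (-D') t).clm_apply hβ
  have const := is_const_of_deriv_eq_zero (fun t => (deriv_zero t).differentiableAt)
    (fun t => (deriv_zero t).deriv) 1 0
  have cancel (z : F) : exp D' (exp (-D') z) = z :=
    congrArg (fun T : F →L[ℝ] F => T z) (exp_mul_exp_neg D')
  simpa [cancel] using congrArg (fun z => exp D' z) const

theorem exp_mul_left_apply {𝔸 : Type*} [NormedRing 𝔸] [NormedAlgebra ℝ 𝔸] [CompleteSpace 𝔸]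
    (a b : 𝔸) : exp (ContinuousLinearMap.mul ℝ 𝔸 a) b = exp a * b := by
  let _ : NormedAlgebra ℚ 𝔸 := NormedAlgebra.restrictScalars ℚ ℝ 𝔸
  let _ : NormedAlgebra ℚ (𝔸 →L[ℝ] 𝔸) := NormedAlgebra.restrictScalars ℚ ℝ _
  let mulLeft : 𝔸 →+* (𝔸 →L[ℝ] 𝔸) :=
    { toFun := ContinuousLinearMap.mul ℝ 𝔸
      map_one' := by ext; simp
      map_mul' := fun x y => by ext; simp [mul_assoc]
      map_zero' := map_zero _
      map_add' := map_add _ }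
  exact DFunLike.congr_fun
    (map_exp mulLeft (ContinuousLinearMap.mul ℝ 𝔸).continuous a).symm b

theorem exists_lieEquiv_of_derivation {𝔥 : Type*} [LieRing 𝔥] [LieAlgebra ℝ 𝔥]
    [FiniteDimensional ℝ 𝔥] (D : LieDerivation ℝ 𝔥 𝔥) (β : 𝔥 →ₗ[ℝ] 𝔥 →ₗ[ℝ] ℂ) (c : ℂ)
    (h : ∀ x y, β (D x) y + β x (D y) = c * β x y) :
    ∃ A : 𝔥 ≃ₗ⁅ℝ⁆ 𝔥, ∀ x y, β (A x) (A y) = Complex.exp c * β x y := by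
  let bracket : 𝔥 →ₗ[ℝ] 𝔥 →ₗ[ℝ] 𝔥 :=
    LinearMap.mk₂ ℝ Bracket.bracket add_lie smul_lie lie_add lie_smul
  let coords := (Module.finBasis ℝ 𝔥).equivFun
  let _ : NormedAddCommGroup 𝔥 :=
    NormedAddCommGroup.induced 𝔥 _ coords.toLinearMap coords.injective
  let _ : NormedSpace ℝ 𝔥 := NormedSpace.induced ℝ 𝔥 _ coords.toLinearMap
  have _ : CompleteSpace 𝔥 := FiniteDimensional.complete ℝ 𝔥
  let D' : 𝔥 →L[ℝ] 𝔥 := LinearMap.toContinuousLinearMap D.toLinearMap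
  have map_lie (x y) : exp D' ⁅x, y⁆ = ⁅exp D' x, exp D' y⁆ :=
    (exp_apply_bilin_of_derivation (D := D') (D' := D') bracket.toContinuousBilinearMap
      (fun x y => by simp [D', bracket, D.apply_lie_eq_add, add_comm]) x y).symm
  let A : 𝔥 ≃ₗ[ℝ] 𝔥 := .ofLinearMap (exp D').toLinearMap (exp (-D')).toLinearMap
    (LinearMap.ext fun x => by simpa using DFunLike.congr_fun (exp_mul_exp_neg D') x)
    (LinearMap.ext fun x => by simpa using DFunLike.congr_fun (exp_mul_exp_neg (-D')) x)
  refine ⟨{ A with map_lie' := map_lie _ _ }, fun x y => ?_⟩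
  have := exp_apply_bilin_of_derivation (D := D') (D' := ContinuousLinearMap.mul ℝ ℂ c)
    β.toContinuousBilinearMap (fun x y => by simp [D', h]) x y
  rw [exp_mul_left_apply, ← Complex.exp_eq_exp_ℂ] at this
  exact this

end Exponential

section ExteriorAlgebra

open CliffordAlgebra (contractLeft contractRight)
open ExteriorAlgebra (ι)

section CommRing

variable {K M N : Type*} [CommRing K] [AddCommGroup M] [Module K M] [AddCommGroup N] [Module K N]

theorem map_contractLeft (φ : M →ₗ[K] N) (d : Module.Dual K N) (A : ExteriorAlgebra K M) :
    ExteriorAlgebra.map φ (contractLeft (d ∘ₗ φ) A) =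
      contractLeft d (ExteriorAlgebra.map φ A) := by
  induction A using CliffordAlgebra.left_induction with
  | algebraMap r => simp [CliffordAlgebra.contractLeft_algebraMap]
  | add x y hx hy => simp only [map_add, hx, hy]
  | ι_mul x m hx =>
    have map_ι_mul (z : ExteriorAlgebra K M) : ExteriorAlgebra.map φ (ι K m * z) =
        ι K (φ m) * ExteriorAlgebra.map φ z := by
      rw [map_mul, ExteriorAlgebra.map_apply_ι]
    rw [CliffordAlgebra.contractLeft_ι_mul, map_sub, map_smul, map_ι_mul, map_ι_mul, hx]
    exact (CliffordAlgebra.contractLeft_ι_mul _ _ _).symm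

theorem map_contractRight (φ : M →ₗ[K] N) (d : Module.Dual K N) (A : ExteriorAlgebra K M) :
    ExteriorAlgebra.map φ (contractRight A (d ∘ₗ φ)) =
      contractRight (ExteriorAlgebra.map φ A) d := by
  induction A using CliffordAlgebra.right_induction with
  | algebraMap r => simp [CliffordAlgebra.contractRight_algebraMap]
  | add x y hx hy => simp only [map_add, LinearMap.add_apply, hx, hy]
  | mul_ι m x hx =>
    have map_mul_ι (z : ExteriorAlgebra K M) : ExteriorAlgebra.map φ (z * ι K m) =
        ExteriorAlgebra.map φ z * ι K (φ m) := by
      rw [map_mul, ExteriorAlgebra.map_apply_ι]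
    rw [CliffordAlgebra.contractRight_mul_ι, map_sub, map_smul, map_mul_ι, map_mul_ι, hx]
    exact (CliffordAlgebra.contractRight_mul_ι _ _ _).symm

theorem coord_map_comp {I : Type*} (e : Module.Basis I K M) (φ : M ≃ₗ[K] N) (i : I) :
    (e.map φ).coord i ∘ₗ φ.toLinearMap = e.coord i := by
  ext x; simp

variable {X I I' : Type*} [AddCommGroup X] [Module K X] [Fintype I] [Fintype I']

theorem sum_basis_coord_eq (e : Module.Basis I K M) (f : Module.Basis I' K M)
    (F : M →ₗ[K] Module.Dual K M →ₗ[K] X) :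
    ∑ i, F (e i) (e.coord i) = ∑ j, F (f j) (f.coord j) := by
  calc ∑ i, F (e i) (e.coord i)
      = ∑ i, ∑ j, F (f j) (f.coord j (e i) • e.coord i) := by
        refine Finset.sum_congr rfl fun i _ => ?_
        conv_lhs => rw [← f.sum_repr (e i), map_sum, LinearMap.sum_apply]
        simp
    _ = ∑ j, F (f j) (∑ i, f.coord j (e i) • e.coord i) := by
        rw [Finset.sum_comm]; simp only [map_sum]
    _ = ∑ j, F (f j) (f.coord j) := by simp only [e.sum_dual_apply_smul_coord]

theorem sum_basis_coord_eq₂ (e : Module.Basis I K M) (f : Module.Basis I' K M)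
    (F : M →ₗ[K] Module.Dual K M →ₗ[K] M →ₗ[K] Module.Dual K M →ₗ[K] X) :
    ∑ i, ∑ j, F (e i) (e.coord i) (e j) (e.coord j) =
      ∑ i, ∑ j, F (f i) (f.coord i) (f j) (f.coord j) := by
  calc ∑ i, ∑ j, F (e i) (e.coord i) (e j) (e.coord j)
      = ∑ i, ∑ j, F (e i) (e.coord i) (f j) (f.coord j) :=
        Finset.sum_congr rfl fun _ _ => sum_basis_coord_eq e f _
    _ = ∑ j, (∑ i, F (e i) (e.coord i)) (f j) (f.coord j) := by
        rw [Finset.sum_comm]; simp only [LinearMap.sum_apply]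
    _ = ∑ i, ∑ j, F (f i) (f.coord i) (f j) (f.coord j) := by
        rw [sum_basis_coord_eq e f F, Finset.sum_comm]; simp only [LinearMap.sum_apply]

theorem map_sum_schouten (e : Module.Basis I K M) (f : Module.Basis I' K N) (φ : M ≃ₗ[K] N)
    (β : M →ₗ[K] M →ₗ[K] M) (β' : N →ₗ[K] N →ₗ[K] N) (h : ∀ x y, φ (β x y) = β' (φ x) (φ y))
    (A B : ExteriorAlgebra K M) :
    ExteriorAlgebra.map φ.toLinearMap (∑ i, ∑ j,
      contractRight A (e.coord i) * ι K (β (e i) (e j)) * contractLeft (e.coord j) B) =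
    ∑ i, ∑ j, contractRight (ExteriorAlgebra.map φ.toLinearMap A) (f.coord i) *
      ι K (β' (f i) (f j)) * contractLeft (f.coord j) (ExteriorAlgebra.map φ.toLinearMap B) := by
  let F : N →ₗ[K] Module.Dual K N →ₗ[K] N →ₗ[K] Module.Dual K N →ₗ[K] ExteriorAlgebra K N :=
    LinearMap.mk₂ K (fun x d => LinearMap.mk₂ K
      (fun y d' => contractRight (ExteriorAlgebra.map φ.toLinearMap A) d * ι K (β' x y) *
        contractLeft d' (ExteriorAlgebra.map φ.toLinearMap B))
      (by simp [mul_add, add_mul]) (by simp) (by simp [mul_add]) (by simp))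
      (by intros; ext; simp [mul_add, add_mul]) (by intros; ext; simp)
      (by intros; ext; simp [add_mul]) (by intros; ext; simp)
  trans ∑ i, ∑ j, F (e.map φ i) ((e.map φ).coord i) (e.map φ j) ((e.map φ).coord j)
  · simp only [F, map_sum, map_mul, LinearMap.mk₂_apply, ← map_contractLeft, ← map_contractRight,
      coord_map_comp, ExteriorAlgebra.map_apply_ι, Module.Basis.map_apply, LinearEquiv.coe_coe, h]
  · exact sum_basis_coord_eq₂ (e.map φ) f F

theorem map_sum_differential (e : Module.Basis I K M) (f : Module.Basis I' K N) (φ : M ≃ₗ[K] N)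
    (c : Module.Dual K M →ₗ[K] Module.Dual K M →ₗ[K] Module.Dual K M)
    (c' : Module.Dual K N →ₗ[K] Module.Dual K N →ₗ[K] Module.Dual K N)
    (h : ∀ d d', c (d ∘ₗ φ.toLinearMap) (d' ∘ₗ φ.toLinearMap) = c' d d' ∘ₗ φ.toLinearMap)
    (A : ExteriorAlgebra K M) :
    ExteriorAlgebra.map φ.toLinearMap (∑ i, ∑ j,
      ι K (e i) * ι K (e j) * contractLeft (c (e.coord i) (e.coord j)) A) =
    ∑ i, ∑ j, ι K (f i) * ι K (f j) *
      contractLeft (c' (f.coord i) (f.coord j)) (ExteriorAlgebra.map φ.toLinearMap A) := by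
  let F : N →ₗ[K] Module.Dual K N →ₗ[K] N →ₗ[K] Module.Dual K N →ₗ[K] ExteriorAlgebra K N :=
    LinearMap.mk₂ K (fun x d => LinearMap.mk₂ K
      (fun y d' => ι K x * ι K y * contractLeft (c' d d') (ExteriorAlgebra.map φ.toLinearMap A))
      (by simp [mul_add, add_mul]) (by simp) (by simp [mul_add]) (by simp))
      (by intros; ext; simp [add_mul]) (by intros; ext; simp)
      (by intros; ext; simp [mul_add]) (by intros; ext; simp)
  trans ∑ i, ∑ j, F (e.map φ i) ((e.map φ).coord i) (e.map φ j) ((e.map φ).coord j)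
  · simp only [F, map_sum, map_mul, LinearMap.mk₂_apply, ← map_contractLeft, ← h,
      coord_map_comp, ExteriorAlgebra.map_apply_ι, Module.Basis.map_apply, LinearEquiv.coe_coe]
  · exact sum_basis_coord_eq₂ (e.map φ) f F

end CommRing

theorem exists_bivector_contractLeft {K M : Type*} [Field K] [CharZero K] [AddCommGroup M]
    [Module K M] [FiniteDimensional K M] (D : Module.Dual K M →ₗ[K] M)
    (hD : ∀ d d' : Module.Dual K M, d (D d') = -d' (D d)) :
    ∃ Λ ∈ ⋀[K]^2 M, ∀ d, contractLeft d Λ = ι K (D d) := by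
  let e := Module.finBasis K M
  have contract_ι (d : Module.Dual K M) (m : M) : contractLeft d (ι K m) = algebraMap K _ (d m) :=
    CliffordAlgebra.contractLeft_ι 0 d m
  have contract_term (d : Module.Dual K M) (i) :
      contractLeft d (ι K (e i) * ι K (D (e.coord i))) =
        ι K (D (d (e i) • e.coord i)) + ι K (e.coord i (D d) • e i) := by
    calc contractLeft d (ι K (e i) * ι K (D (e.coord i)))
        = d (e i) • ι K (D (e.coord i)) - ι K (e i) * contractLeft d (ι K (D (e.coord i))) :=
          CliffordAlgebra.contractLeft_ι_mul _ _ _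
      _ = ι K (D (d (e i) • e.coord i)) + ι K (e.coord i (D d) • e i) := by
          rw [contract_ι, hD, ← Algebra.commutes, ← Algebra.smul_def]
          simp
  refine ⟨(1 / 2 : K) • ∑ i, ι K (e i) * ι K (D (e.coord i)),
    Submodule.smul_mem _ _ (Submodule.sum_mem _ fun i _ => ?_), fun d => ?_⟩
  · change _ ∈ LinearMap.range (ι K) ^ 2
    rw [pow_two]
    exact Submodule.mul_mem_mul ⟨_, rfl⟩ ⟨_, rfl⟩
  · have sum_repr : ∑ i, e.coord i (D d) • e i = D d := e.sum_repr (D d)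
    calc contractLeft d ((1 / 2 : K) • ∑ i, ι K (e i) * ι K (D (e.coord i)))
        = (1 / 2 : K) • (ι K (D (∑ i, d (e i) • e.coord i)) +
            ι K (∑ i, e.coord i (D d) • e i)) := by
          simp only [map_smul, map_sum, contract_term, Finset.sum_add_distrib]
      _ = (1 / 2 : K) • (ι K (D d) + ι K (D d)) := by
          rw [e.sum_dual_apply_smul_coord, sum_repr]
      _ = ι K (D d) := by rw [← two_smul K, smul_smul]; norm_num

end ExteriorAlgebra

section Courant

variable {𝔥 : Type*} [LieRing 𝔥] [LieAlgebra ℝ 𝔥]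

theorem complexification_ext {X : Type*} [AddCommGroup X] [Module ℂ X]
    {F G : (ℂ ⊗[ℝ] 𝔥) →ₗ[ℂ] X} (h : ∀ x, F (1 ⊗ₜ x) = G (1 ⊗ₜ x)) : F = G := by
  refine LinearMap.ext fun Y => ?_
  obtain ⟨x, y, rfl⟩ := exists_re_im Y
  have I_tmul : (Complex.I ⊗ₜ[ℝ] y : ℂ ⊗[ℝ] 𝔥) = Complex.I • ((1 : ℂ) ⊗ₜ[ℝ] y) := by
    rw [TensorProduct.smul_tmul', smul_eq_mul, mul_one]
  simp only [I_tmul, map_add, map_smul, h]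

theorem complexification_ext₂ {X : Type*} [AddCommGroup X] [Module ℂ X]
    {F G : (ℂ ⊗[ℝ] 𝔥) →ₗ[ℂ] (ℂ ⊗[ℝ] 𝔥) →ₗ[ℂ] X}
    (h : ∀ x y, F (1 ⊗ₜ x) (1 ⊗ₜ y) = G (1 ⊗ₜ x) (1 ⊗ₜ y)) : F = G :=
  complexification_ext fun x => complexification_ext (h x)

/-- The Lie bracket of the complexification as a bilinear map. -/
def cxBracket : (ℂ ⊗[ℝ] 𝔥) →ₗ[ℂ] (ℂ ⊗[ℝ] 𝔥) →ₗ[ℂ] (ℂ ⊗[ℝ] 𝔥) :=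
  LinearMap.mk₂ ℂ (fun X Y => ⁅X, Y⁆) cx_add_lie cx_smul_lie cx_lie_add cx_lie_smul

/-- The Courant bracket as a bilinear map. -/
def courantBilin : GenTangent 𝔥 →ₗ[ℂ] GenTangent 𝔥 →ₗ[ℂ] GenTangent 𝔥 :=
  LinearMap.mk₂ ℂ courant
    (fun a b c => Prod.ext (cx_add_lie _ _ _) <| LinearMap.ext fun Z => by
      simp only [courant, lieDer_apply, Prod.fst_add, Prod.snd_add, add_lie, map_add,
        Prod.mk_add_mk, LinearMap.add_apply, LinearMap.sub_apply]
      ring)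
    (fun r a b => Prod.ext (cx_smul_lie _ _ _) <| LinearMap.ext fun Z => by
      simp only [courant, lieDer_apply, Prod.smul_fst, Prod.smul_snd, smul_lie, map_smul,
        Prod.smul_mk, smul_eq_mul, LinearMap.smul_apply, LinearMap.sub_apply]
      ring)
    (fun a b c => Prod.ext (cx_lie_add _ _ _) <| LinearMap.ext fun Z => by
      simp only [courant, lieDer_apply, Prod.fst_add, Prod.snd_add, add_lie, map_add,
        Prod.mk_add_mk, LinearMap.add_apply, LinearMap.sub_apply]
      ring)
    (fun r a b => Prod.ext (cx_lie_smul _ _ _) <| LinearMap.ext fun Z => by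
      simp only [courant, lieDer_apply, Prod.smul_fst, Prod.smul_snd, smul_lie, map_smul,
        Prod.smul_mk, smul_eq_mul, LinearMap.smul_apply, LinearMap.sub_apply]
      ring)

theorem conjV_lie (X Y : ℂ ⊗[ℝ] 𝔥) : conjV ⁅X, Y⁆ = ⁅conjV X, conjV Y⁆ := by
  induction X with
  | zero => simp
  | add x x' hx hx' => simp only [map_add, cx_add_lie, hx, hx']
  | tmul z v =>
    induction Y with
    | zero => simp [cx_lie_zero]
    | add y y' hy hy' => simp only [map_add, cx_lie_add, hy, hy']
    | tmul w u => simp [LieAlgebra.ExtendScalars.bracket_tmul]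

theorem conjE_conjE (a : GenTangent 𝔥) : conjE (conjE a) = a :=
  Prod.ext (conjV_conjV _) <| LinearMap.ext fun X => by simp [conjE_apply, conjD_apply]

theorem conjE_courant (a b : GenTangent 𝔥) :
    conjE (courant a b) = courant (conjE a) (conjE b) :=
  Prod.ext (conjV_lie _ _) <| LinearMap.ext fun X => by
    simp only [courant, conjE_apply, conjD_apply, lieDer_apply, LinearMap.sub_apply, map_sub,
      map_neg, conjV_lie, conjV_conjV]

end Courant

namespace GenComplex

variable {𝔥 𝔥' : Type*} [LieRing 𝔥] [LieAlgebra ℝ 𝔥] [LieRing 𝔥'] [LieAlgebra ℝ 𝔥']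

/-- The bracket of `L` as a bilinear map. -/
def bracketBilin (𝒥 : GenComplex 𝔥) : 𝒥.L →ₗ[ℂ] 𝒥.L →ₗ[ℂ] 𝒥.L :=
  LinearMap.mk₂ ℂ 𝒥.bracketL
    (fun a b c => Subtype.ext (courantBilin.map_add₂ (a : GenTangent 𝔥) b c))
    (fun r a b => Subtype.ext (courantBilin.map_smul₂ r (a : GenTangent 𝔥) b))
    (fun a b c => Subtype.ext (map_add (courantBilin (a : GenTangent 𝔥)) (b : GenTangent 𝔥) c))
    (fun r a b => Subtype.ext (map_smul (courantBilin (a : GenTangent 𝔥)) r (b : GenTangent 𝔥)))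

/-- The functional on `L` defined by the conjugate of an element of `L`, which encodes the
Hermitian form `(x, y) ↦ 2 ⟨conj x, y⟩` of `L`. -/
def conjDual (𝒥 : GenComplex 𝔥) (x : 𝒥.L) : Module.Dual ℂ 𝒥.L :=
  𝒥.restrictL (conjE (x : GenTangent 𝔥))

section FiniteDimensional

variable [FiniteDimensional ℝ 𝔥] [FiniteDimensional ℝ 𝔥']

theorem coe_conjEquivDual_symm_conjDual (𝒥 : GenComplex 𝔥) (x : 𝒥.L) :
    (𝒥.conjEquivDual.symm (𝒥.conjDual x) : GenTangent 𝔥) = conjE (x : GenTangent 𝔥) := by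
  have conj_mem : conjE (x : GenTangent 𝔥) ∈ conjSub 𝒥.L := by
    rw [mem_conjSub, conjE_conjE]; exact x.2
  exact congrArg Subtype.val (𝒥.conjEquivDual.symm_apply_apply ⟨_, conj_mem⟩)

theorem conjDual_surjective (𝒥 : GenComplex 𝔥) : Function.Surjective 𝒥.conjDual := by
  intro d
  obtain ⟨m, rfl⟩ := 𝒥.conjEquivDual.surjective d
  exact ⟨⟨conjE (m : GenTangent 𝔥), m.2⟩, congrArg 𝒥.restrictL (conjE_conjE _)⟩

/-- The bracket of `conj L` transported to the dual of `L`. -/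
def dualBracket (𝒥 : GenComplex 𝔥) :
    Module.Dual ℂ 𝒥.L →ₗ[ℂ] Module.Dual ℂ 𝒥.L →ₗ[ℂ] Module.Dual ℂ 𝒥.L :=
  (courantBilin.compl₁₂ ((conjSub 𝒥.L).subtype ∘ₗ 𝒥.conjEquivDual.symm.toLinearMap)
    ((conjSub 𝒥.L).subtype ∘ₗ 𝒥.conjEquivDual.symm.toLinearMap)).compr₂ 𝒥.restrictL

theorem dualBracket_conjDual (𝒥 : GenComplex 𝔥) (x y : 𝒥.L) :
    𝒥.dualBracket (𝒥.conjDual x) (𝒥.conjDual y) = 𝒥.conjDual (𝒥.bracketL x y) := by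
  change 𝒥.restrictL (courant (𝒥.conjEquivDual.symm (𝒥.conjDual x) : GenTangent 𝔥)
    (𝒥.conjEquivDual.symm (𝒥.conjDual y) : GenTangent 𝔥)) = _
  rw [coe_conjEquivDual_symm_conjDual, coe_conjEquivDual_symm_conjDual, ← conjE_courant]
  rfl

section LieEquiv

variable {𝒥₁ : GenComplex 𝔥} {𝒥₂ : GenComplex 𝔥'} (φ : 𝒥₁.L ≃ₗ[ℂ] 𝒥₂.L)
  (map_bracket : ∀ x y, φ (𝒥₁.bracketL x y) = 𝒥₂.bracketL (φ x) (φ y))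
  (sigma_conj_map : ∀ x y, sigma (conjE (φ x : GenTangent 𝔥')) (φ y : GenTangent 𝔥') =
    sigma (conjE (x : GenTangent 𝔥)) (y : GenTangent 𝔥))

include map_bracket sigma_conj_map

theorem map_dbar_of_lieEquiv (A : ExteriorAlgebra ℂ 𝒥₁.L) :
    ExteriorAlgebra.map φ.toLinearMap (𝒥₁.dbar A) =
      𝒥₂.dbar (ExteriorAlgebra.map φ.toLinearMap A) := by
  have conjDual_comp (x : 𝒥₁.L) : 𝒥₂.conjDual (φ x) ∘ₗ φ.toLinearMap = 𝒥₁.conjDual x :=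
    LinearMap.ext (sigma_conj_map x)
  have map_dualBracket (d d' : Module.Dual ℂ 𝒥₂.L) :
      𝒥₁.dualBracket (d ∘ₗ φ.toLinearMap) (d' ∘ₗ φ.toLinearMap) =
        𝒥₂.dualBracket d d' ∘ₗ φ.toLinearMap := by
    obtain ⟨x, rfl⟩ := 𝒥₂.conjDual_surjective.comp φ.surjective d
    obtain ⟨y, rfl⟩ := 𝒥₂.conjDual_surjective.comp φ.surjective d'
    simp only [Function.comp_apply, conjDual_comp, dualBracket_conjDual, ← map_bracket]
  rw [dbar, map_smul]
  exact congrArg ((-(1 / 2) : ℂ) • ·)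
    (map_sum_differential _ (Module.finBasis ℂ 𝒥₂.L) φ _ _ map_dualBracket A)

/-- An isomorphism of the Lie algebras `L` that preserves their Hermitian forms induces an
isomorphism of differential Gerstenhaber algebras. -/
def DGAEquiv.ofLieEquiv : DGAEquiv 𝒥₁ 𝒥₂ where
  toAlgEquiv := AlgEquiv.ofAlgHom (ExteriorAlgebra.map φ.toLinearMap)
    (ExteriorAlgebra.map φ.symm.toLinearMap)
    (by rw [ExteriorAlgebra.map_comp_map]; simp)
    (by rw [ExteriorAlgebra.map_comp_map]; simp)
  map_degree n A hA := by
    have map_le : (⋀[ℂ]^n 𝒥₁.L).map (ExteriorAlgebra.map φ.toLinearMap).toLinearMap ≤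
        ⋀[ℂ]^n 𝒥₂.L := by
      change (LinearMap.range (ExteriorAlgebra.ι ℂ) ^ n).map _ ≤
        LinearMap.range (ExteriorAlgebra.ι ℂ) ^ n
      rw [Submodule.map_pow, ExteriorAlgebra.ι_range_map_map]
      exact pow_le_pow_left' LinearMap.map_le_range n
    exact map_le ⟨A, hA, rfl⟩
  map_schouten A B := map_sum_schouten (Module.finBasis ℂ 𝒥₁.L) (Module.finBasis ℂ 𝒥₂.L) φ
    𝒥₁.bracketBilin 𝒥₂.bracketBilin map_bracket A B
  map_dbar A := map_dbar_of_lieEquiv φ map_bracket sigma_conj_map A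

end LieEquiv

theorem finrank_L (𝒥 : GenComplex 𝔥) : Module.finrank ℂ 𝒥.L = Module.finrank ℂ (ℂ ⊗[ℝ] 𝔥) := by
  have finrank_conj : Module.finrank ℂ (conjSub 𝒥.L) = Module.finrank ℂ 𝒥.L :=
    𝒥.conjEquivDual.finrank_eq.trans Subspace.dual_finrank_eq
  have finrank_add := Submodule.finrank_add_eq_of_isCompl 𝒥.isCompl
  rw [finrank_conj, Module.finrank_prod, Subspace.dual_finrank_eq] at finrank_add
  lia

end FiniteDimensional

/-- A realization of the Lie algebra `L` of `𝒥` as the complexification of a Lie algebra `𝔥'`,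
under which the Hermitian form `(x, y) ↦ 2 ⟨conj x, y⟩` of `L` is `2i Ω(conj X, Y)` for the
2-form `Ω` on `𝔥'`. -/
structure IsModel (𝒥 : GenComplex 𝔥) (Ω : LinearMap.BilinForm ℝ 𝔥')
    (f : (ℂ ⊗[ℝ] 𝔥') →ₗ[ℂ] 𝒥.L) : Prop where
  map_lie : ∀ X Y, f ⁅X, Y⁆ = 𝒥.bracketL (f X) (f Y)
  sigma_conj : ∀ X Y, sigma (conjE (f X : GenTangent 𝔥)) (f Y : GenTangent 𝔥) =
    2 * Complex.I * Ω.baseChange ℂ (conjV X) Y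

namespace IsModel

variable {𝒥 : GenComplex 𝔥} {Ω : LinearMap.BilinForm ℝ 𝔥'} {f : (ℂ ⊗[ℝ] 𝔥') →ₗ[ℂ] 𝒥.L}

theorem of_real
    (map_lie : ∀ x y : 𝔥', f (1 ⊗ₜ ⁅x, y⁆) = 𝒥.bracketL (f (1 ⊗ₜ x)) (f (1 ⊗ₜ y)))
    (sigma_conj : ∀ x y : 𝔥', sigma (conjE (f (1 ⊗ₜ x) : GenTangent 𝔥)) (f (1 ⊗ₜ y)) =
      2 * Complex.I * Ω x y) : 𝒥.IsModel Ω f where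
  map_lie := by
    have bilin_eq : cxBracket.compr₂ f = 𝒥.bracketBilin.compl₁₂ f f :=
      complexification_ext₂ fun x y => by
        have : cxBracket ((1 : ℂ) ⊗ₜ[ℝ] x) ((1 : ℂ) ⊗ₜ[ℝ] y) = 1 ⊗ₜ ⁅x, y⁆ := by
          simp [cxBracket, LieAlgebra.ExtendScalars.bracket_tmul]
        rw [LinearMap.compr₂_apply, this, map_lie]
        rfl
    exact fun X Y => LinearMap.congr_fun₂ bilin_eq X Y
  sigma_conj := by
    let incl : (ℂ ⊗[ℝ] 𝔥') →ₗ[ℂ] GenTangent 𝔥 := 𝒥.L.subtype ∘ₗ f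
    let conjIncl : (ℂ ⊗[ℝ] 𝔥') →ₗ[ℂ] GenTangent 𝔥 := conjE.comp (incl.comp conjV)
    have bilin_eq : sigma.compl₁₂ conjIncl incl = (2 * Complex.I) • Ω.baseChange ℂ :=
      complexification_ext₂ fun x y => by simp [incl, conjIncl, sigma_conj]
    exact fun X Y => by simpa [incl, conjIncl] using LinearMap.congr_fun₂ bilin_eq (conjV X) Y

variable {𝔥₂ : Type*} [LieRing 𝔥₂] [LieAlgebra ℝ 𝔥₂] {𝒥₂ : GenComplex 𝔥₂}
  {f₂ : (ℂ ⊗[ℝ] 𝔥') →ₗ[ℂ] 𝒥₂.L}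

theorem comp_lieHom {𝔥'' : Type*} [LieRing 𝔥''] [LieAlgebra ℝ 𝔥''] (hf : 𝒥.IsModel Ω f)
    {Ω' : LinearMap.BilinForm ℝ 𝔥''} (A : 𝔥'' →ₗ⁅ℝ⁆ 𝔥') (h : ∀ x y, Ω (A x) (A y) = Ω' x y) :
    𝒥.IsModel Ω' (f ∘ₗ A.toLinearMap.baseChange ℂ) :=
  of_real (fun x y => by simp [← hf.map_lie, LieAlgebra.ExtendScalars.bracket_tmul])
    (fun x y => by simp [hf.sigma_conj, h])

theorem injective (hf : 𝒥.IsModel Ω f) (hΩ : Ω.Nondegenerate) : Function.Injective f := by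
  rw [injective_iff_map_eq_zero]
  intro X hX
  have conj_eq_zero : Ω.baseChange ℂ (conjV X) = 0 := LinearMap.ext fun Y => by
    simpa [hX] using hf.sigma_conj X Y
  rw [← conjV_conjV X, baseChange_injective hΩ (conj_eq_zero.trans (map_zero _).symm), map_zero]

variable [FiniteDimensional ℝ 𝔥] [FiniteDimensional ℝ 𝔥'] [FiniteDimensional ℝ 𝔥₂]

theorem bijective (hf : 𝒥.IsModel Ω f) (hΩ : Ω.Nondegenerate)
    (finrank_eq : Module.finrank ℝ 𝔥' = Module.finrank ℝ 𝔥) : Function.Bijective f := by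
  have finrank_eq_L : Module.finrank ℂ (ℂ ⊗[ℝ] 𝔥') = Module.finrank ℂ 𝒥.L := by
    rw [finrank_L, Module.finrank_baseChange, Module.finrank_baseChange, finrank_eq]
  exact ⟨hf.injective hΩ, (LinearMap.injective_iff_surjective_of_finrank_eq_finrank
    finrank_eq_L).1 (hf.injective hΩ)⟩

theorem nonempty_dgaEquiv (hf : 𝒥.IsModel Ω f) (hf₂ : 𝒥₂.IsModel Ω f₂) (hΩ : Ω.Nondegenerate)
    (finrank_eq : Module.finrank ℝ 𝔥' = Module.finrank ℝ 𝔥)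
    (finrank_eq₂ : Module.finrank ℝ 𝔥' = Module.finrank ℝ 𝔥₂) : Nonempty (DGAEquiv 𝒥 𝒥₂) := by
  let e := LinearEquiv.ofBijective f (hf.bijective hΩ finrank_eq)
  let e₂ := LinearEquiv.ofBijective f₂ (hf₂.bijective hΩ finrank_eq₂)
  refine ⟨.ofLieEquiv (e.symm.trans e₂) (fun x y => ?_) (fun x y => ?_)⟩ <;>
    obtain ⟨X, rfl⟩ := e.surjective x <;> obtain ⟨Y, rfl⟩ := e.surjective y
  · have symm_bracket : e.symm (𝒥.bracketL (e X) (e Y)) = ⁅X, Y⁆ :=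
      e.symm_apply_eq.2 (hf.map_lie X Y).symm
    simp only [LinearEquiv.trans_apply, symm_bracket, LinearEquiv.symm_apply_apply]
    exact hf₂.map_lie X Y
  · simp only [LinearEquiv.trans_apply, LinearEquiv.symm_apply_apply]
    exact (hf₂.sigma_conj X Y).trans (hf.sigma_conj X Y).symm

end IsModel

end GenComplex

section Symplectic

variable {𝔥 : Type*} [LieRing 𝔥] [LieAlgebra ℝ 𝔥] {Ω : LinearMap.BilinForm ℝ 𝔥}

theorem conjD_baseChange (Ω : LinearMap.BilinForm ℝ 𝔥) (X : ℂ ⊗[ℝ] 𝔥) :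
    conjD (Ω.baseChange ℂ X) = Ω.baseChange ℂ (conjV X) :=
  LinearMap.ext fun Z => by rw [conjD_apply, ← baseChange_conj, conjV_conjV]

variable [FiniteDimensional ℝ 𝔥]

theorem mem_ofSymplectic (hΩ : IsSymplectic Ω) (a : GenTangent 𝔥) :
    a ∈ (ofSymplectic Ω hΩ).L ↔ a.2 = -(Complex.I • Ω.baseChange ℂ a.1) := by
  constructor
  · rintro ⟨X, rfl⟩
    rfl
  · exact fun h => ⟨a.1, Prod.ext rfl h.symm⟩

/-- The realization `X ↦ X - i ι_X Ω` of the Lie algebra `L` of a symplectic form. -/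
def symplecticMap (hΩ : IsSymplectic Ω) : (ℂ ⊗[ℝ] 𝔥) →ₗ[ℂ] (ofSymplectic Ω hΩ).L :=
  LinearMap.rangeRestrict (LinearMap.prod LinearMap.id (-(Complex.I • Ω.baseChange ℂ)))

theorem coe_symplecticMap (hΩ : IsSymplectic Ω) (X : ℂ ⊗[ℝ] 𝔥) :
    (symplecticMap hΩ X : GenTangent 𝔥) = (X, -(Complex.I • Ω.baseChange ℂ X)) := rfl

theorem isModel_symplecticMap (hΩ : IsSymplectic Ω) :
    (ofSymplectic Ω hΩ).IsModel Ω (symplecticMap hΩ) where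
  map_lie X Y := by
    have mem_L := ((ofSymplectic Ω hΩ).bracketL (symplecticMap hΩ X) (symplecticMap hΩ Y)).2
    exact Subtype.ext (Prod.ext rfl ((mem_ofSymplectic hΩ _).1 mem_L).symm)
  sigma_conj X Y := by
    simp only [coe_symplecticMap, sigma_apply, conjE_apply, map_neg, map_smulₛₗ, Complex.conj_I,
      conjD_baseChange, neg_smul, neg_neg, LinearMap.neg_apply, LinearMap.smul_apply, smul_eq_mul,
      baseChange_alt hΩ.isAlt Y (conjV X)]
    ring

end Symplectic

section BField

variable {𝔥 : Type*} [LieRing 𝔥] [LieAlgebra ℝ 𝔥]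

theorem bField_apply (B : LinearMap.BilinForm ℝ 𝔥) (a : GenTangent 𝔥) :
    bField B a = (a.1, a.2 + B.baseChange ℂ a.1) := by
  ext1 <;> simp [bField]

theorem pairing_bField {B : LinearMap.BilinForm ℝ 𝔥} (hB : B.IsAlt) (a b : GenTangent 𝔥) :
    pairing (bField B a) (bField B b) = pairing a b := by
  simp only [bField_apply, pairing, LinearMap.add_apply, baseChange_alt hB b.1 a.1]
  ring

theorem courant_bField {B : LinearMap.BilinForm ℝ 𝔥} (hB : B.IsAlt) (hB' : IsClosedForm B)
    (a b : GenTangent 𝔥) :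
    courant (bField B a) (bField B b) = bField B (courant a b) := by
  simp only [bField_apply]
  refine Prod.ext rfl (LinearMap.ext fun Z => ?_)
  have closed := baseChange_closed hB' a.1 b.1 Z
  have alt := baseChange_alt hB ⁅b.1, Z⁆ a.1
  have alt' : B.baseChange ℂ ⁅Z, a.1⁆ b.1 = B.baseChange ℂ b.1 ⁅a.1, Z⁆ := by
    rw [cx_lie_skew Z a.1, map_neg, LinearMap.neg_apply, ← baseChange_alt hB]
  simp only [courant, lieDer_apply, LinearMap.sub_apply, LinearMap.add_apply]
  linear_combination -closed + alt + alt'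

theorem conjE_bField (B : LinearMap.BilinForm ℝ 𝔥) (a : GenTangent 𝔥) :
    conjE (bField B a) = bField B (conjE a) := by
  simp only [bField_apply, conjE_apply, map_add, conjD_baseChange]

/-- The `B`-field transformation as an automorphism of the generalized tangent space. -/
def bFieldEquiv (B : LinearMap.BilinForm ℝ 𝔥) : GenTangent 𝔥 ≃ₗ[ℂ] GenTangent 𝔥 :=
  { bField B with
    invFun := fun a => (a.1, a.2 - B.baseChange ℂ a.1)
    left_inv := fun a => by simp [bField_apply]
    right_inv := fun a => by simp [bField_apply] }

theorem conjSub_map_bField (B : LinearMap.BilinForm ℝ 𝔥) (L : Submodule ℂ (GenTangent 𝔥)) :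
    conjSub (L.map (bField B)) = (conjSub L).map (bField B) := by
  ext a
  constructor
  · rintro ⟨b, hb, hab⟩
    refine ⟨conjE b, ?_, by rw [← conjE_bField, hab, conjE_conjE]⟩
    rwa [SetLike.mem_coe, mem_conjSub, conjE_conjE]
  · rintro ⟨b, hb, rfl⟩
    exact ⟨conjE b, hb, (conjE_bField B b).symm⟩

/-- The `B`-field transformation of a generalized complex structure by a closed 2-form. -/
def GenComplex.bTransform (𝒥 : GenComplex 𝔥) {B : LinearMap.BilinForm ℝ 𝔥} (hB : B.IsAlt)
    (hB' : IsClosedForm B) : GenComplex 𝔥 where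
  L := 𝒥.L.map (bField B)
  isotropic := by
    rintro _ ⟨a, ha, rfl⟩ _ ⟨b, hb, rfl⟩
    rw [pairing_bField hB, 𝒥.isotropic a ha b hb]
  isCompl := by
    rw [conjSub_map_bField]
    exact (Submodule.orderIsoMapComap (bFieldEquiv B)).isCompl 𝒥.isCompl
  closed := by
    rintro _ ⟨a, ha, rfl⟩ _ ⟨b, hb, rfl⟩
    exact ⟨_, 𝒥.closed a ha b hb, (courant_bField hB hB' a b).symm⟩

theorem mem_map_bField_ofSymplectic [FiniteDimensional ℝ 𝔥] {Ω : LinearMap.BilinForm ℝ 𝔥}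
    (hΩ : IsSymplectic Ω) (B : LinearMap.BilinForm ℝ 𝔥) (a : GenTangent 𝔥) :
    a ∈ (ofSymplectic Ω hΩ).L.map (bField B) ↔
      B.baseChange ℂ a.1 - Complex.I • Ω.baseChange ℂ a.1 = a.2 := by
  constructor
  · rintro ⟨b, hb, rfl⟩
    rw [bField_apply, (mem_ofSymplectic hΩ b).1 hb, neg_add_eq_sub]
  · intro h
    refine ⟨(a.1, a.2 - B.baseChange ℂ a.1), (mem_ofSymplectic hΩ _).2 ?_, ?_⟩
    · rw [← h, sub_sub_cancel_left]
    · rw [bField_apply, sub_add_cancel]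

end BField

namespace GenComplex

variable {𝔥 : Type*} [LieRing 𝔥] [LieAlgebra ℝ 𝔥] [FiniteDimensional ℝ 𝔥] (𝒥 : GenComplex 𝔥)

theorem exists_contraction_eq (θ : conjSub 𝒥.L →ₗ[ℂ] 𝒥.L)
    (hθ : ∀ m m' : conjSub 𝒥.L, sigma (m' : GenTangent 𝔥) (θ m : GenTangent 𝔥) =
      -sigma (m : GenTangent 𝔥) (θ m' : GenTangent 𝔥)) :
    ∃ Λ ∈ ⋀[ℂ]^2 𝒥.L, 𝒥.contraction Λ = θ := by
  obtain ⟨Λ, hΛ, contract⟩ := exists_bivector_contractLeft (K := ℂ)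
    (θ ∘ₗ 𝒥.conjEquivDual.symm.toLinearMap) (fun d d' => by
      obtain ⟨m, rfl⟩ := 𝒥.conjEquivDual.surjective d
      obtain ⟨m', rfl⟩ := 𝒥.conjEquivDual.surjective d'
      simp only [LinearMap.comp_apply, LinearEquiv.coe_coe, LinearEquiv.symm_apply_apply]
      exact hθ m' m)
  refine ⟨Λ, hΛ, LinearMap.ext fun m => ?_⟩
  change ExteriorAlgebra.ιInv (CliffordAlgebra.contractLeft (𝒥.conjEquivDual m) Λ) = θ m
  rw [contract, ExteriorAlgebra.ι_leftInverse, LinearMap.comp_apply, LinearEquiv.coe_coe,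
    LinearEquiv.symm_apply_apply]

theorem contraction_smul (c : ℂ) (Γ : ExteriorAlgebra ℂ 𝒥.L) :
    𝒥.contraction (c • Γ) = c • 𝒥.contraction Γ := by
  simp only [contraction, map_smul, LinearMap.smul_comp, LinearMap.comp_smul]

/-- The contraction with `Γ` extends to the square-zero map `N`, so `1 + N` has the inverse
`1 - N`. -/
theorem mem_deform_iff_of_sq_eq_zero {Γ : ExteriorAlgebra ℂ 𝒥.L}
    {N : GenTangent 𝔥 →ₗ[ℂ] GenTangent 𝔥} (sq_eq_zero : ∀ a, N (N a) = 0)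
    (hΓ : ∀ m : conjSub 𝒥.L, (𝒥.contraction Γ m : GenTangent 𝔥) = N m) (a : GenTangent 𝔥) :
    a ∈ 𝒥.deform Γ ↔ conjE (conjE a - N (conjE a)) ∈ 𝒥.L := by
  have mem_deform : a ∈ 𝒥.deform Γ ↔ ∃ m : conjSub 𝒥.L, (m : GenTangent 𝔥) + N m = conjE a := by
    simp only [← hΓ]; rfl
  rw [mem_deform]
  constructor
  · rintro ⟨m, hm⟩
    rw [← hm, map_add, sq_eq_zero, add_zero, add_sub_cancel_right]
    exact m.2
  · exact fun h => ⟨⟨_, h⟩, by rw [map_sub, sq_eq_zero, sub_zero, sub_add_cancel]⟩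

end GenComplex

section Deformation

variable {𝔥 : Type*} [LieRing 𝔥] [LieAlgebra ℝ 𝔥] {J : 𝔥 →ₗ[ℝ] 𝔥} {Ω : LinearMap.BilinForm ℝ 𝔥}

theorem IsClosedForm.smul {B : LinearMap.BilinForm ℝ 𝔥} (hB : IsClosedForm B) (c : ℝ) :
    IsClosedForm (c • B) := fun x y z => by
  simp only [LinearMap.smul_apply, ← smul_add, hB x y z, smul_zero]

theorem IsSymplectic.smul (hΩ : IsSymplectic Ω) {c : ℝ} (hc : c ≠ 0) : IsSymplectic (c • Ω) where
  isAlt x := by simp [hΩ.isAlt x]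
  nondegenerate :=
    ⟨fun x hx => hΩ.nondegenerate.1 x fun y => (smul_eq_zero.1 (hx y)).resolve_left hc,
      fun y hy => hΩ.nondegenerate.2 y fun x => (smul_eq_zero.1 (hy x)).resolve_left hc⟩
  closed := hΩ.closed.smul c

theorem baseChange_smul (c : ℝ) (Ω : LinearMap.BilinForm ℝ 𝔥) :
    (c • Ω).baseChange ℂ = (c : ℂ) • Ω.baseChange ℂ :=
  complexification_ext₂ fun x y => by simp

theorem baseChange_comp (Ω : LinearMap.BilinForm ℝ 𝔥) (J : 𝔥 →ₗ[ℝ] 𝔥) (X : ℂ ⊗[ℝ] 𝔥) :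
    LinearMap.BilinForm.baseChange ℂ (Ω ∘ₗ J) X = Ω.baseChange ℂ (J.baseChange ℂ X) := by
  have : LinearMap.BilinForm.baseChange ℂ (Ω ∘ₗ J) = Ω.baseChange ℂ ∘ₗ J.baseChange ℂ :=
    complexification_ext₂ fun x y => by simp
  rw [this, LinearMap.comp_apply]

theorem baseChange_comp_comm (hΩ : Ω.IsAlt) (hΩJ : LinearMap.BilinForm.IsAlt (Ω ∘ₗ J))
    (X Y : ℂ ⊗[ℝ] 𝔥) :
    Ω.baseChange ℂ (J.baseChange ℂ X) Y = Ω.baseChange ℂ X (J.baseChange ℂ Y) := by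
  rw [← baseChange_comp, baseChange_alt hΩJ, baseChange_alt hΩ X, baseChange_comp]

theorem add_smul_baseChange_mem_T10 (hJ : ∀ x, J (J x) = -x) (X : ℂ ⊗[ℝ] 𝔥) :
    J.baseChange ℂ X + Complex.I • X ∈ T10 J := by
  rw [mem_T10, map_add, map_smul, baseChange_sq hJ, smul_add, smul_smul, Complex.I_mul_I]
  module

theorem baseChange_mem_dualAnnihilator_T10_iff (hJ : ∀ x, J (J x) = -x) (hΩ : IsSymplectic Ω)
    (hΩJ : LinearMap.BilinForm.IsAlt (Ω ∘ₗ J)) (W : ℂ ⊗[ℝ] 𝔥) :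
    Ω.baseChange ℂ W ∈ (T10 J).dualAnnihilator ↔ J.baseChange ℂ W = -(Complex.I • W) := by
  rw [Submodule.mem_dualAnnihilator]
  constructor
  · intro hW
    refine baseChange_injective hΩ.nondegenerate (LinearMap.ext fun Y => ?_)
    have vanish := hW _ (add_smul_baseChange_mem_T10 hJ Y)
    rw [map_add, map_smul, ← baseChange_comp_comm hΩ.isAlt hΩJ] at vanish
    simp only [map_neg, map_smul, LinearMap.neg_apply, LinearMap.smul_apply]
    exact eq_neg_of_add_eq_zero_left vanish
  · intro hW Y hY
    have comm := baseChange_comp_comm hΩ.isAlt hΩJ W Y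
    rw [hW, mem_T10.1 hY] at comm
    simp only [map_neg, map_smul, LinearMap.neg_apply, LinearMap.smul_apply, smul_eq_mul] at comm
    have double : (2 * Complex.I) * Ω.baseChange ℂ W Y = 0 := by linear_combination -comm
    exact (mul_eq_zero.1 double).resolve_left (by simp)

theorem sub_smul_mem_T10_iff {W : ℂ ⊗[ℝ] 𝔥} (hW : J.baseChange ℂ W = -(Complex.I • W)) (t : ℂ)
    (Z : ℂ ⊗[ℝ] 𝔥) : Z - (t * (Complex.I / 2)) • W ∈ T10 J ↔
      J.baseChange ℂ Z - Complex.I • Z = t • W := by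
  have eigen_defect : J.baseChange ℂ (Z - (t * (Complex.I / 2)) • W) -
      Complex.I • (Z - (t * (Complex.I / 2)) • W) =
        J.baseChange ℂ Z - Complex.I • Z - t • W := by
    rw [map_sub, map_smul, hW]
    match_scalars
    · ring
    · linear_combination t * Complex.I_mul_I
    · ring
  rw [mem_T10, ← sub_eq_zero, eigen_defect, sub_eq_zero]

variable [FiniteDimensional ℝ 𝔥]

/-- The complexified musical isomorphism `X ↦ ι_X Ω` of a non-degenerate form. -/
def cxFlat (hΩ : Ω.Nondegenerate) : (ℂ ⊗[ℝ] 𝔥) ≃ₗ[ℂ] Module.Dual ℂ (ℂ ⊗[ℝ] 𝔥) :=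
  LinearEquiv.ofBijective (Ω.baseChange ℂ)
    ⟨baseChange_injective hΩ, (LinearMap.injective_iff_surjective_of_finrank_eq_finrank
      (Subspace.dual_finrank_eq).symm).1 (baseChange_injective hΩ)⟩

theorem cxFlat_apply (hΩ : Ω.Nondegenerate) (X : ℂ ⊗[ℝ] 𝔥) :
    cxFlat hΩ X = Ω.baseChange ℂ X := rfl

theorem cxFlat_symm_conjD (hΩ : Ω.Nondegenerate) (α : Module.Dual ℂ (ℂ ⊗[ℝ] 𝔥)) :
    (cxFlat hΩ).symm (conjD α) = conjV ((cxFlat hΩ).symm α) := by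
  obtain ⟨W, rfl⟩ := (cxFlat hΩ).surjective α
  rw [LinearEquiv.symm_apply_apply, LinearEquiv.symm_apply_eq, cxFlat_apply, cxFlat_apply,
    conjD_baseChange]

/-- The bivector `-(i/2) Ω⁻¹` as an endomorphism of the generalized tangent space. -/
def bivectorMap (hΩ : Ω.Nondegenerate) : GenTangent 𝔥 →ₗ[ℂ] GenTangent 𝔥 :=
  LinearMap.inl ℂ _ _ ∘ₗ ((-(Complex.I / 2) : ℂ) • (cxFlat hΩ).symm.toLinearMap) ∘ₗ
    LinearMap.snd ℂ _ _

theorem bivectorMap_apply (hΩ : Ω.Nondegenerate) (a : GenTangent 𝔥) :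
    bivectorMap hΩ a = ((-(Complex.I / 2)) • (cxFlat hΩ).symm a.2, 0) := rfl

theorem bivectorMap_mem_ofComplex (hJ : IsComplexStructure J) (hΩ : IsSymplectic Ω)
    (hΩJ : LinearMap.BilinForm.IsAlt (Ω ∘ₗ J)) {m : GenTangent 𝔥}
    (hm : m ∈ conjSub (ofComplex J hJ).L) :
    bivectorMap hΩ.nondegenerate m ∈ (ofComplex J hJ).L := by
  refine ⟨Submodule.smul_mem _ _ ?_, Submodule.zero_mem _⟩
  have conj_mem : conjD m.2 ∈ (T10 J).dualAnnihilator := hm.2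
  obtain ⟨W, hW⟩ := (cxFlat hΩ.nondegenerate).surjective m.2
  rw [← hW, cxFlat_apply, conjD_baseChange, baseChange_mem_dualAnnihilator_T10_iff hJ.1 hΩ hΩJ,
    baseChange_conjV] at conj_mem
  change (cxFlat hΩ.nondegenerate).symm m.2 ∈ T10 J
  rw [← hW, LinearEquiv.symm_apply_apply, mem_T10]
  simpa using congrArg conjV conj_mem

theorem sigma_bivectorMap_skew (hΩ : IsSymplectic Ω) (a b : GenTangent 𝔥) :
    sigma b (bivectorMap hΩ.nondegenerate a) = -sigma a (bivectorMap hΩ.nondegenerate b) := by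
  obtain ⟨W, hW⟩ := (cxFlat hΩ.nondegenerate).surjective a.2
  obtain ⟨W', hW'⟩ := (cxFlat hΩ.nondegenerate).surjective b.2
  rw [bivectorMap_apply, bivectorMap_apply, sigma_apply, sigma_apply, ← hW, ← hW',
    LinearEquiv.symm_apply_apply, LinearEquiv.symm_apply_apply, cxFlat_apply, cxFlat_apply,
    map_smul, map_smul, baseChange_alt hΩ.isAlt W' W]
  simp

section Contraction

variable (hJ : IsComplexStructure J) (hΩ : IsSymplectic Ω)
  (hΩJ : LinearMap.BilinForm.IsAlt (Ω ∘ₗ J)) {Γ : ExteriorAlgebra ℂ (ofComplex J hJ).L} {t : ℝ}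
  (hΓ : ∀ m : conjSub (ofComplex J hJ).L, ((ofComplex J hJ).contraction Γ m : GenTangent 𝔥) =
    (t : ℂ) • bivectorMap hΩ.nondegenerate m)

include hΩJ hΓ

theorem mem_deform_ofComplex_iff (a : GenTangent 𝔥) :
    a ∈ (ofComplex J hJ).deform Γ ↔ a.2 ∈ (T10 J).dualAnnihilator ∧
      Ω.baseChange ℂ (J.baseChange ℂ a.1 - Complex.I • a.1) = (t : ℂ) • a.2 := by
  obtain ⟨Z, α⟩ := a
  obtain ⟨W, rfl⟩ := (cxFlat hΩ.nondegenerate).surjective α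
  have mem_iff := (ofComplex J hJ).mem_deform_iff_of_sq_eq_zero
    (N := (t : ℂ) • bivectorMap hΩ.nondegenerate)
    (fun a => by simp [bivectorMap_apply]) hΓ (Z, cxFlat hΩ.nondegenerate W)
  have undeformed : conjE (conjE (Z, cxFlat hΩ.nondegenerate W) -
      (t : ℂ) • bivectorMap hΩ.nondegenerate (conjE (Z, cxFlat hΩ.nondegenerate W))) =
        (Z - ((t : ℂ) * (Complex.I / 2)) • W, cxFlat hΩ.nondegenerate W) := by
    rw [map_sub, conjE_conjE, bivectorMap_apply]
    simp only [conjE_apply, cxFlat_symm_conjD, LinearEquiv.symm_apply_apply, map_smulₛₗ,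
      Complex.conj_ofReal, conjV_conjV, map_neg, map_div₀, Complex.conj_I, map_ofNat, map_zero]
    ext1
    · simp only [Prod.fst_sub, Prod.smul_fst]
      module
    · simp
  rw [mem_iff, LinearMap.smul_apply, undeformed]
  change _ ∈ T10 J ∧ _ ∈ (T10 J).dualAnnihilator ↔ _
  rw [and_comm]
  refine and_congr_right fun hα => ?_
  rw [cxFlat_apply, baseChange_mem_dualAnnihilator_T10_iff hJ.1 hΩ hΩJ] at hα
  rw [sub_smul_mem_T10_iff hα, cxFlat_apply, ← map_smul,
    (baseChange_injective hΩ.nondegenerate).eq_iff]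

theorem deform_ofComplex_eq_self (ht : t = 0) :
    (ofComplex J hJ).deform Γ = (ofComplex J hJ).L := by
  ext a
  rw [mem_deform_ofComplex_iff hJ hΩ hΩJ hΓ, ht, Complex.ofReal_zero, zero_smul, and_comm]
  refine and_congr_left fun _ => ?_
  rw [map_eq_zero_iff _ (baseChange_injective hΩ.nondegenerate), sub_eq_zero]
  exact mem_T10.symm

theorem mem_deform_ofComplex_iff_of_ne_zero (ht : t ≠ 0) (a : GenTangent 𝔥) :
    a ∈ (ofComplex J hJ).deform Γ ↔
      LinearMap.BilinForm.baseChange ℂ (Ω ∘ₗ J) a.1 - Complex.I • Ω.baseChange ℂ a.1 =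
        (t : ℂ) • a.2 := by
  rw [mem_deform_ofComplex_iff hJ hΩ hΩJ hΓ, map_sub, map_smul, ← baseChange_comp,
    and_iff_right_iff_imp]
  intro ha
  refine (Submodule.smul_mem_iff _ (Complex.ofReal_ne_zero.2 ht)).1 ?_
  rw [← ha, Submodule.mem_dualAnnihilator]
  intro Y hY
  rw [LinearMap.sub_apply, LinearMap.smul_apply, baseChange_comp,
    baseChange_comp_comm hΩ.isAlt hΩJ, mem_T10.1 hY, map_smul, sub_self]

theorem isGenComplex_deform_ofComplex (closed : IsClosedForm (Ω ∘ₗ J)) :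
    IsGenComplex ((ofComplex J hJ).deform Γ) := by
  rcases eq_or_ne t 0 with ht | ht
  · exact ⟨ofComplex J hJ, (deform_ofComplex_eq_self hJ hΩ hΩJ hΓ ht).symm⟩
  · let 𝒥 := (ofSymplectic _ (hΩ.smul (inv_ne_zero ht))).bTransform
      (B := t⁻¹ • (Ω ∘ₗ J)) (fun x => by simpa using Or.inr (hΩJ x)) (closed.smul t⁻¹)
    refine ⟨𝒥, Submodule.ext fun a => ?_⟩
    change a ∈ (ofSymplectic _ (hΩ.smul (inv_ne_zero ht))).L.map (bField (t⁻¹ • (Ω ∘ₗ J))) ↔ _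
    rw [mem_deform_ofComplex_iff_of_ne_zero hJ hΩ hΩJ hΓ ht, mem_map_bField_ofSymplectic,
      baseChange_smul, baseChange_smul, LinearMap.smul_apply, LinearMap.smul_apply,
      smul_comm Complex.I, ← smul_sub, Complex.ofReal_inv,
      inv_smul_eq_iff₀ (Complex.ofReal_ne_zero.2 ht)]

end Contraction

theorem exists_deform_ofComplex_eq (hJ : IsComplexStructure J) (hΩ : IsSymplectic Ω)
    (hΩJ : LinearMap.BilinForm.IsAlt (Ω ∘ₗ J)) (closed : IsClosedForm (Ω ∘ₗ J)) :
    ∃ Λ ∈ ⋀[ℂ]^2 (ofComplex J hJ).L,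
      (∀ t : ℝ, IsGenComplex ((ofComplex J hJ).deform ((t : ℂ) • Λ))) ∧
      (ofComplex J hJ).deform Λ = (ofSymplectic Ω hΩ).L.map (bField (Ω ∘ₗ J)) := by
  obtain ⟨Λ, hΛ, contraction_eq⟩ := (ofComplex J hJ).exists_contraction_eq
    ((bivectorMap hΩ.nondegenerate).restrict fun m hm => bivectorMap_mem_ofComplex hJ hΩ hΩJ hm)
    (fun m m' => sigma_bivectorMap_skew hΩ m m')
  have contraction_apply (t : ℝ) (m : conjSub (ofComplex J hJ).L) :
      ((ofComplex J hJ).contraction ((t : ℂ) • Λ) m : GenTangent 𝔥) =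
        (t : ℂ) • bivectorMap hΩ.nondegenerate m := by
    rw [GenComplex.contraction_smul, contraction_eq]; rfl
  refine ⟨Λ, hΛ, fun t => isGenComplex_deform_ofComplex hJ hΩ hΩJ (contraction_apply t) closed,
    Submodule.ext fun a => ?_⟩
  have mem_iff := mem_deform_ofComplex_iff_of_ne_zero hJ hΩ hΩJ (contraction_apply 1) one_ne_zero a
  rw [Complex.ofReal_one, one_smul, one_smul] at mem_iff
  rw [mem_iff, mem_map_bField_ofSymplectic]

end Deformation

section Structures

variable {𝔤 : Type*} [LieRing 𝔤] [LieAlgebra ℝ 𝔤] {γ : FlatConnection 𝔤}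
  {ω g : LinearMap.BilinForm ℝ 𝔤}

namespace SemiProd

theorem fst_J (a : SemiProd γ) : fst γ (J γ a) = -snd γ a := rfl

theorem snd_J (a : SemiProd γ) : snd γ (J γ a) = fst γ a := rfl

theorem Ω₁_apply (a b : SemiProd γ) :
    Ω₁ γ ω a b = -ω (fst γ a) (snd γ b) - ω (snd γ a) (fst γ b) := rfl

theorem Ω₂_apply (a b : SemiProd γ) :
    Ω₂ γ ω a b = ω (fst γ a) (fst γ b) - ω (snd γ a) (snd γ b) := rfl

theorem Ω₃_apply (a b : SemiProd γ) :
    Ω₃ γ ω a b = ω (fst γ a) (fst γ b) + ω (snd γ a) (snd γ b) := rfl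

theorem Δ_apply (a b : SemiProd γ) :
    Δ γ g a b = g (fst γ a) (fst γ b) + g (snd γ a) (snd γ b) := rfl

theorem Ω₁_eq_Ω₂_comp_J (γ : FlatConnection 𝔤) (ω : LinearMap.BilinForm ℝ 𝔤) :
    Ω₁ γ ω = Ω₂ γ ω ∘ₗ J γ := by
  ext a b
  rw [LinearMap.comp_apply, Ω₁_apply, Ω₂_apply, fst_J, snd_J, map_neg, LinearMap.neg_apply]
  ring

theorem isComplexStructure_J (hγ : IsTorsionFree γ) : IsComplexStructure (J γ) := by
  refine ⟨fun _ => ext' rfl rfl, fun x y => ext' ?_ ?_⟩ <;>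
  · simp only [fst_J, snd_J, fst_lie, snd_lie, map_sub, ← hγ _ _, map_neg, LinearMap.neg_apply,
      map_zero]
    abel

theorem nondegenerate_add_smul (hg : g.Nondegenerate) {c : ℝ} (hc : c ≠ 0) :
    (g.compl₁₂ (fst γ) (fst γ) + c • g.compl₁₂ (snd γ) (snd γ)).Nondegenerate := by
  constructor
  · refine fun a ha => ext' (hg.1 _ fun y => ?_) (hg.1 _ fun y => ?_)
    · simpa using ha (mk γ y 0)
    · simpa [hc] using ha (mk γ 0 y)
  · refine fun a ha => ext' (hg.2 _ fun y => ?_) (hg.2 _ fun y => ?_)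
    · simpa using ha (mk γ y 0)
    · simpa [hc] using ha (mk γ 0 y)

theorem cyclic_sum_snd_lie (hω : ω.IsAlt) (hγω : IsSymplecticConnection γ ω)
    (a b c : SemiProd γ) :
    ω (snd γ ⁅a, b⁆) (snd γ c) + ω (snd γ ⁅b, c⁆) (snd γ a) + ω (snd γ ⁅c, a⁆) (snd γ b) = 0 := by
  have symm (x v w : 𝔤) : ω (γ x v) w = ω (γ x w) v := by
    linear_combination hγω x v w + hω.neg_eq v (γ x w)
  simp only [snd_lie, map_sub, LinearMap.sub_apply]
  linear_combination symm (fst γ a) (snd γ b) (snd γ c) + symm (fst γ b) (snd γ c) (snd γ a) +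
    symm (fst γ c) (snd γ a) (snd γ b)

theorem isSymplectic_Ω₂ (hω : IsSymplectic ω) (hγω : IsSymplecticConnection γ ω) :
    IsSymplectic (Ω₂ γ ω) where
  isAlt a := by rw [Ω₂_apply, hω.isAlt, hω.isAlt, sub_zero]
  nondegenerate := by
    convert nondegenerate_add_smul (γ := γ) hω.nondegenerate (neg_ne_zero.2 one_ne_zero) using 1
    ext
    simp [Ω₂_apply, sub_eq_add_neg]
  closed a b c := by
    simp only [Ω₂_apply, fst_lie]
    linear_combination hω.closed (fst γ a) (fst γ b) (fst γ c) -
      cyclic_sum_snd_lie hω.isAlt hγω a b c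

theorem isSymplectic_Ω₃ (hω : IsSymplectic ω) (hγω : IsSymplecticConnection γ ω) :
    IsSymplectic (Ω₃ γ ω) where
  isAlt a := by rw [Ω₃_apply, hω.isAlt, hω.isAlt, add_zero]
  nondegenerate := by
    simpa [Ω₃] using nondegenerate_add_smul (γ := γ) hω.nondegenerate one_ne_zero
  closed a b c := by
    simp only [Ω₃_apply, fst_lie]
    linear_combination hω.closed (fst γ a) (fst γ b) (fst γ c) +
      cyclic_sum_snd_lie hω.isAlt hγω a b c

theorem isClosedForm_Ω₁ (hω : ω.IsAlt) (hγ : IsTorsionFree γ)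
    (hγω : IsSymplecticConnection γ ω) : IsClosedForm (Ω₁ γ ω) := by
  have torsion (x y w : 𝔤) : -ω ⁅x, y⁆ w - ω (γ y w) x + ω (γ x w) y = 0 := by
    rw [← hγ, map_sub, LinearMap.sub_apply]
    linear_combination hω.neg_eq (γ y w) x - hω.neg_eq (γ x w) y - hγω x y w + hγω y x w
  intro a b c
  simp only [Ω₁_apply, fst_lie, snd_lie, map_sub, LinearMap.sub_apply]
  linear_combination torsion (fst γ a) (fst γ b) (snd γ c) +
    torsion (fst γ b) (fst γ c) (snd γ a) + torsion (fst γ c) (fst γ a) (snd γ b)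

theorem isSymplectic_Ω₁ (hω : IsSymplectic ω) (hγ : IsTorsionFree γ)
    (hγω : IsSymplecticConnection γ ω) : IsSymplectic (Ω₁ γ ω) := by
  have alt : (Ω₁ γ ω).IsAlt := fun a => by
    rw [Ω₁_apply, ← hω.isAlt.neg_eq]
    ring
  refine ⟨alt, (LinearMap.IsRefl.nondegenerate_iff_separatingLeft alt.isRefl).2 fun a ha => ?_,
    isClosedForm_Ω₁ hω.isAlt hγ hγω⟩
  rw [Ω₁_eq_Ω₂_comp_J] at ha
  have J_eq_zero := (isSymplectic_Ω₂ hω hγω).nondegenerate.1 (J γ a) ha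
  simpa [J_eq_zero] using (isComplexStructure_J hγ).1 a

theorem isPseudoMetric_Δ (γ : FlatConnection 𝔤) (hg : IsPseudoMetric g) :
    IsPseudoMetric (Δ γ g) where
  isSymm := ⟨fun a b => by
    rw [Δ_apply, Δ_apply, hg.isSymm.eq (fst γ a) (fst γ b), hg.isSymm.eq (snd γ a) (snd γ b)]⟩
  nondegenerate := by
    simpa [Δ] using nondegenerate_add_smul (γ := γ) hg.nondegenerate one_ne_zero

end SemiProd

end Structures

section Rotation

variable {𝔤 : Type*} [LieRing 𝔤] [LieAlgebra ℝ 𝔤] [FiniteDimensional ℝ 𝔤]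
  {γ : FlatConnection 𝔤} {ω g : LinearMap.BilinForm ℝ 𝔤}

theorem apply_invComp (hg : g.Nondegenerate) (a b : 𝔤) : g (invComp g hg ω a) b = ω a b :=
  LinearMap.BilinForm.apply_toDual_symm_apply (hB := hg) (ω a) b

theorem skew_invComp (hω : ω.IsAlt) (hg : IsPseudoMetric g) (a b : 𝔤) :
    ω (invComp g hg.nondegenerate ω a) b = -ω a (invComp g hg.nondegenerate ω b) := by
  rw [← apply_invComp (ω := ω) hg.nondegenerate a, hg.isSymm.eq, apply_invComp, hω.neg_eq]

theorem invComp_injective (hω : ω.Nondegenerate) (hg : g.Nondegenerate) :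
    Function.Injective (invComp g hg ω) :=
  (injective_iff_map_eq_zero _).2 fun y hy => hω.1 y fun z => by
    rw [← apply_invComp hg, hy, map_zero, LinearMap.zero_apply]

theorem metric_dual_connection (hω : ω.Nondegenerate) (hg : IsPseudoMetric g)
    (hγω : IsSymplecticConnection γ ω)
    (hT : ∀ a b, invComp g hg.nondegenerate ω (γ a b) =
      γ (invComp g hg.nondegenerate ω a) (invComp g hg.nondegenerate ω b)) (x a b : 𝔤) :
    g (γ (invComp g hg.nondegenerate ω x) a) b = -g a (γ x b) := by
  obtain ⟨a, rfl⟩ := LinearMap.surjective_of_injective (invComp_injective hω hg.nondegenerate) a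
  rw [← hT, apply_invComp, apply_invComp]
  linear_combination hγω x a b

theorem connection_invComp_invComp (hω : ω.Nondegenerate) (hg : IsPseudoMetric g)
    (hγω : IsSymplecticConnection γ ω)
    (hT : ∀ a b, invComp g hg.nondegenerate ω (γ a b) =
      γ (invComp g hg.nondegenerate ω a) (invComp g hg.nondegenerate ω b)) (x : 𝔤) :
    γ (invComp g hg.nondegenerate ω (invComp g hg.nondegenerate ω x)) = γ x := by
  refine LinearMap.ext fun a => sub_eq_zero.1 <| hg.nondegenerate.1 _ fun b => ?_
  rw [map_sub, LinearMap.sub_apply, metric_dual_connection hω hg hγω hT, hg.isSymm.eq a,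
    metric_dual_connection hω hg hγω hT, hg.isSymm.eq b]
  ring

theorem connection_sub_invComp_symm (hω : ω.Nondegenerate) (hg : IsPseudoMetric g)
    (hγ : IsTorsionFree γ) (hγω : IsSymplecticConnection γ ω)
    (hT : ∀ a b, invComp g hg.nondegenerate ω (γ a b) =
      γ (invComp g hg.nondegenerate ω a) (invComp g hg.nondegenerate ω b))
    (closed : IsClosedForm (SemiProd.Δ γ g ∘ₗ SemiProd.J γ)) (x y : 𝔤) :
    γ (x - invComp g hg.nondegenerate ω x) y = γ (y - invComp g hg.nondegenerate ω y) x := by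
  refine sub_eq_zero.1 <| hg.nondegenerate.1 _ fun w => ?_
  have closed_xyw := closed (SemiProd.mk γ x 0) (SemiProd.mk γ y 0) (SemiProd.mk γ 0 w)
  simp only [LinearMap.comp_apply, SemiProd.Δ_apply, SemiProd.fst_J, SemiProd.snd_J,
    SemiProd.fst_lie, SemiProd.snd_lie, SemiProd.fst_mk, SemiProd.snd_mk, map_zero, map_neg,
    LinearMap.neg_apply, LinearMap.zero_apply, lie_zero, zero_lie, ← hγ x y, map_sub,
    LinearMap.sub_apply] at closed_xyw
  simp only [map_sub, LinearMap.sub_apply]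
  linear_combination closed_xyw - metric_dual_connection hω hg hγω hT x y w +
    metric_dual_connection hω hg hγω hT y x w + hg.isSymm.eq (γ y w) x - hg.isSymm.eq (γ x w) y

end Rotation

section RotationDerivation

namespace SemiProd

variable {𝔤 : Type*} [LieRing 𝔤] [LieAlgebra ℝ 𝔤] {γ : FlatConnection 𝔤}
  {ω : LinearMap.BilinForm ℝ 𝔤} {T : 𝔤 →ₗ[ℝ] 𝔤}

variable (γ T) in
/-- The endomorphism `(x, u) ↦ (-(1 - T) u, (1 - T) x)`, which for `T = g⁻¹ω` is an infinitesimal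
rotation of the pair `(Ω₁, Ω₂)`. -/
def rotation : SemiProd γ →ₗ[ℝ] SemiProd γ :=
  J γ ∘ₗ LinearMap.prodMap (LinearMap.id - T) (LinearMap.id - T)

theorem fst_rotation (a : SemiProd γ) : fst γ (rotation γ T a) = -(snd γ a - T (snd γ a)) := rfl

theorem snd_rotation (a : SemiProd γ) : snd γ (rotation γ T a) = fst γ a - T (fst γ a) := rfl

theorem connection_apply_sub (hT : ∀ x y, T (γ x y) = γ (T x) (T y))
    (hT_sq : ∀ x, γ (T (T x)) = γ x) (hT_symm : ∀ x y, γ (x - T x) y = γ (y - T y) x) (x y : 𝔤) :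
    γ x y - T (γ x y) = γ x (y - T y) - γ (y - T y) x := by
  have twisted : γ (x - T x) (T y) = -γ (y - T y) x := by
    rw [hT_symm, map_sub, hT_sq, map_sub, ← LinearMap.neg_apply, neg_sub]
  rw [← neg_eq_iff_eq_neg.2 twisted]
  simp [hT]

theorem rotation_lie (hγ : IsTorsionFree γ) (hT : ∀ x y, T (γ x y) = γ (T x) (T y))
    (hT_sq : ∀ x, γ (T (T x)) = γ x) (hT_symm : ∀ x y, γ (x - T x) y = γ (y - T y) x)
    (a b : SemiProd γ) :
    rotation γ T ⁅a, b⁆ = ⁅a, rotation γ T b⁆ - ⁅b, rotation γ T a⁆ := by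
  have defect := connection_apply_sub hT hT_sq hT_symm
  refine ext' ?_ ?_
  · rw [fst_rotation, snd_lie, map_sub (fst γ), fst_lie, fst_lie, fst_rotation, fst_rotation,
      map_sub T, sub_sub_sub_comm, defect, defect, ← hγ, ← hγ]
    simp only [map_neg, LinearMap.neg_apply]
    abel
  · rw [snd_rotation, fst_lie, map_sub (snd γ), snd_lie, snd_lie, fst_rotation, fst_rotation,
      snd_rotation, snd_rotation, ← hγ, map_sub T, sub_sub_sub_comm, defect, defect,
      hT_symm (fst γ a)]
    simp only [map_neg, LinearMap.neg_apply]
    rw [hT_symm (snd γ b)]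
    abel

/-- The infinitesimal rotation as a derivation of `𝔤 ⋉_γ V`. -/
def rotationDerivation (hγ : IsTorsionFree γ) (hT : ∀ x y, T (γ x y) = γ (T x) (T y))
    (hT_sq : ∀ x, γ (T (T x)) = γ x) (hT_symm : ∀ x y, γ (x - T x) y = γ (y - T y) x) :
    LieDerivation ℝ (SemiProd γ) (SemiProd γ) where
  toLinearMap := rotation γ T
  leibniz' := rotation_lie hγ hT hT_sq hT_symm

theorem Ω₂_rotation (hTω : ∀ x y, ω (T x) y = -ω x (T y)) (a b : SemiProd γ) :
    Ω₂ γ ω (rotation γ T a) b + Ω₂ γ ω a (rotation γ T b) = 2 * Ω₁ γ ω a b := by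
  simp only [Ω₁_apply, Ω₂_apply, fst_rotation, snd_rotation, map_sub, map_neg,
    LinearMap.sub_apply, LinearMap.neg_apply, hTω]
  ring

theorem Ω₁_rotation (hTω : ∀ x y, ω (T x) y = -ω x (T y)) (a b : SemiProd γ) :
    Ω₁ γ ω (rotation γ T a) b + Ω₁ γ ω a (rotation γ T b) = -(2 * Ω₂ γ ω a b) := by
  simp only [Ω₁_apply, Ω₂_apply, fst_rotation, snd_rotation, map_sub, map_neg,
    LinearMap.sub_apply, LinearMap.neg_apply, hTω]
  ring

variable (γ ω) in
/-- The complex-valued form `Ω₂ - i Ω₁`. -/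
def complexForm : SemiProd γ →ₗ[ℝ] SemiProd γ →ₗ[ℝ] ℂ :=
  (Ω₂ γ ω).compr₂ (Algebra.linearMap ℝ ℂ) -
    Complex.I • (Ω₁ γ ω).compr₂ (Algebra.linearMap ℝ ℂ)

theorem complexForm_apply (a b : SemiProd γ) :
    complexForm γ ω a b = Ω₂ γ ω a b - Complex.I * Ω₁ γ ω a b := rfl

theorem complexForm_rotation (hTω : ∀ x y, ω (T x) y = -ω x (T y)) (a b : SemiProd γ) :
    complexForm γ ω (rotation γ T a) b + complexForm γ ω a (rotation γ T b) =
      2 * Complex.I * complexForm γ ω a b := by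
  simp only [complexForm_apply]
  have rotate₁ := congrArg Complex.ofReal (Ω₁_rotation (γ := γ) hTω a b)
  have rotate₂ := congrArg Complex.ofReal (Ω₂_rotation (γ := γ) hTω a b)
  push_cast at rotate₁ rotate₂
  linear_combination rotate₂ - Complex.I * rotate₁ + 2 * (Ω₁ γ ω a b : ℂ) * Complex.I_mul_I

theorem exists_lieEquiv_Ω₂_eq_Ω₁ [FiniteDimensional ℝ 𝔤] (hγ : IsTorsionFree γ)
    (hT : ∀ x y, T (γ x y) = γ (T x) (T y)) (hT_sq : ∀ x, γ (T (T x)) = γ x)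
    (hT_symm : ∀ x y, γ (x - T x) y = γ (y - T y) x) (hTω : ∀ x y, ω (T x) y = -ω x (T y)) :
    ∃ A : SemiProd γ ≃ₗ⁅ℝ⁆ SemiProd γ, ∀ a b, Ω₂ γ ω (A a) (A b) = Ω₁ γ ω a b := by
  obtain ⟨A, hA⟩ := exists_lieEquiv_of_derivation
    ((Real.pi / 4) • rotationDerivation hγ hT hT_sq hT_symm) (complexForm γ ω)
    (Real.pi / 2 * Complex.I) fun a b => by
      have rotate := complexForm_rotation (γ := γ) hTω a b
      change complexForm γ ω ((Real.pi / 4) • rotation γ T a) b +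
        complexForm γ ω a ((Real.pi / 4) • rotation γ T b) = _
      simp only [map_smul, LinearMap.smul_apply, Complex.real_smul]
      push_cast
      linear_combination (Real.pi / 4 : ℂ) * rotate
  refine ⟨A, fun a b => ?_⟩
  have := congrArg Complex.re (hA a b)
  simpa [Complex.exp_pi_div_two_mul_I, complexForm_apply] using this

end SemiProd

end RotationDerivation

section ComplexModel

variable {𝔤 : Type*} [LieRing 𝔤] [LieAlgebra ℝ 𝔤] {γ : FlatConnection 𝔤}
  {ω : LinearMap.BilinForm ℝ 𝔤}

namespace SemiProd

variable (γ) in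
/-- The inclusion `x ↦ (x, 0)` of `𝔤`. -/
def inl : 𝔤 →ₗ[ℝ] SemiProd γ := LinearMap.inl ℝ 𝔤 𝔤

variable (γ) in
/-- The isomorphism `x ↦ (x, 0) - i J(x, 0)` from `𝔤_ℂ` to the `(1,0)`-vectors. -/
def holLift : (ℂ ⊗[ℝ] 𝔤) →ₗ[ℂ] (ℂ ⊗[ℝ] SemiProd γ) :=
  (inl γ).baseChange ℂ - Complex.I • (J γ ∘ₗ inl γ).baseChange ℂ

theorem holLift_one_tmul (x : 𝔤) :
    holLift γ (1 ⊗ₜ x) = 1 ⊗ₜ mk γ x 0 + (-Complex.I) ⊗ₜ mk γ 0 x := by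
  have J_inl : J γ (inl γ x) = mk γ 0 x := ext' neg_zero rfl
  change 1 ⊗ₜ mk γ x 0 - Complex.I • ((1 : ℂ) ⊗ₜ[ℝ] J γ (inl γ x)) = _
  rw [J_inl, TensorProduct.smul_tmul', smul_eq_mul, mul_one, TensorProduct.neg_tmul,
    sub_eq_add_neg]

theorem holLift_mem_T10 (hJ : ∀ a, J γ (J γ a) = -a) (X : ℂ ⊗[ℝ] 𝔤) :
    holLift γ X ∈ T10 (J γ) := by
  rw [mem_T10, holLift, LinearMap.baseChange_comp]
  simp only [LinearMap.sub_apply, LinearMap.smul_apply, LinearMap.comp_apply, map_sub, map_smul,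
    baseChange_sq hJ, smul_sub, smul_smul, Complex.I_mul_I]
  module

theorem holLift_lie (hγ : IsTorsionFree γ) (x y : 𝔤) :
    holLift γ (1 ⊗ₜ ⁅x, y⁆) = ⁅holLift γ (1 ⊗ₜ x), holLift γ (1 ⊗ₜ y)⁆ := by
  have lie_horizontal : ⁅mk γ x 0, mk γ y 0⁆ = mk γ ⁅x, y⁆ 0 := ext' rfl (by simp)
  have lie_mixed : ⁅mk γ x 0, mk γ 0 y⁆ + ⁅mk γ 0 x, mk γ y 0⁆ = mk γ 0 ⁅x, y⁆ :=
    ext' (by simp) (by simp [← hγ x y, sub_eq_add_neg])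
  have lie_vertical : ⁅mk γ 0 x, mk γ 0 y⁆ = 0 := ext' (by simp) (by simp)
  simp only [holLift_one_tmul, cx_add_lie, cx_lie_add, LieAlgebra.ExtendScalars.bracket_tmul,
    lie_horizontal, lie_vertical, ← lie_mixed, one_mul, mul_one, TensorProduct.tmul_zero,
    TensorProduct.tmul_add]
  abel

variable (γ) in
/-- The `𝔤_ℂ`-valued form `(x, u) ↦ u + i x`, through which the `(0,1)`-forms factor. -/
def antiholForm : (ℂ ⊗[ℝ] SemiProd γ) →ₗ[ℂ] (ℂ ⊗[ℝ] 𝔤) :=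
  (snd γ).baseChange ℂ + Complex.I • (fst γ).baseChange ℂ

theorem antiholForm_tmul (z : ℂ) (a : SemiProd γ) :
    antiholForm γ (z ⊗ₜ a) = z ⊗ₜ snd γ a + (Complex.I * z) ⊗ₜ fst γ a := rfl

theorem antiholForm_eq_zero {Y : ℂ ⊗[ℝ] SemiProd γ} (hY : Y ∈ T10 (J γ)) :
    antiholForm γ Y = 0 := by
  have fst_J_eq : fst γ ∘ₗ J γ = -snd γ := rfl
  have snd_eq := congrArg ((fst γ).baseChange ℂ) (mem_T10.1 hY)
  rw [← LinearMap.comp_apply, ← LinearMap.baseChange_comp, fst_J_eq, LinearMap.baseChange_neg,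
    LinearMap.neg_apply, map_smul] at snd_eq
  rw [antiholForm, LinearMap.add_apply, LinearMap.smul_apply, ← snd_eq, add_neg_cancel]

theorem antiholForm_lie (hγ : IsTorsionFree γ) (x : 𝔤) (a : SemiProd γ) :
    antiholForm γ ⁅holLift γ (1 ⊗ₜ x), 1 ⊗ₜ a⁆ =
      (γ x).baseChange ℂ (antiholForm γ (1 ⊗ₜ a)) := by
  rw [holLift_one_tmul, cx_add_lie, LieAlgebra.ExtendScalars.bracket_tmul,
    LieAlgebra.ExtendScalars.bracket_tmul, map_add, antiholForm_tmul, antiholForm_tmul,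
    antiholForm_tmul]
  simp only [fst_lie, snd_lie, fst_mk, snd_mk, map_add, LinearMap.baseChange_tmul, ← hγ x,
    zero_lie, map_zero, LinearMap.zero_apply, sub_zero, zero_sub, mul_one, TensorProduct.tmul_sub,
    TensorProduct.tmul_neg, TensorProduct.neg_tmul, TensorProduct.tmul_zero]
  abel

variable (γ ω) in
/-- The `(0,1)`-form `(y, v) ↦ ω(u, v + i y)` attached to `u`. -/
def antiholDual : (ℂ ⊗[ℝ] 𝔤) →ₗ[ℂ] Module.Dual ℂ (ℂ ⊗[ℝ] SemiProd γ) :=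
  (ω.baseChange ℂ).compl₂ (antiholForm γ)

theorem antiholDual_apply (U : ℂ ⊗[ℝ] 𝔤) (Y : ℂ ⊗[ℝ] SemiProd γ) :
    antiholDual γ ω U Y = ω.baseChange ℂ U (antiholForm γ Y) := rfl

theorem lieDer_antiholDual (hγ : IsTorsionFree γ) (hγω : IsSymplecticConnection γ ω) (x v : 𝔤) :
    lieDer (holLift γ (1 ⊗ₜ x)) (antiholDual γ ω (1 ⊗ₜ v)) = antiholDual γ ω (1 ⊗ₜ γ x v) := by
  refine complexification_ext fun a => ?_
  have skew (y : 𝔤) : ω v (γ x y) = -ω (γ x v) y := by linear_combination hγω x v y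
  rw [lieDer_apply, antiholDual_apply, antiholDual_apply, antiholForm_lie hγ, antiholForm_tmul]
  simp only [map_add, LinearMap.baseChange_tmul, LinearMap.BilinForm.baseChange_tmul, skew,
    neg_smul]
  ring

/-- The realization `(x, u) ↦ x - i J x + ω(u, -)` of the Lie algebra `L_J`, where `x` is read
as `(x, 0)` and `ω(u, -)` as a `(0,1)`-form. -/
def complexMap (ω : LinearMap.BilinForm ℝ 𝔤) (hJ : IsComplexStructure (J γ)) :
    (ℂ ⊗[ℝ] SemiProd γ) →ₗ[ℂ] (ofComplex (J γ) hJ).L :=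
  LinearMap.codRestrict _
    (LinearMap.prod (holLift γ ∘ₗ (fst γ).baseChange ℂ) (antiholDual γ ω ∘ₗ (snd γ).baseChange ℂ))
    fun X => ⟨holLift_mem_T10 hJ.1 _, (Submodule.mem_dualAnnihilator _).2 fun Y hY => by
      simp [antiholDual_apply, antiholForm_eq_zero hY]⟩

theorem coe_complexMap (hJ : IsComplexStructure (J γ)) (a : SemiProd γ) :
    (complexMap ω hJ (1 ⊗ₜ a) : GenTangent (SemiProd γ)) =
      (holLift γ (1 ⊗ₜ fst γ a), antiholDual γ ω (1 ⊗ₜ snd γ a)) := rfl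

theorem conjD_antiholDual (u x : 𝔤) :
    conjD (antiholDual γ ω (1 ⊗ₜ u)) (holLift γ (1 ⊗ₜ x)) = -(2 * Complex.I) * ω u x := by
  rw [conjD_apply, antiholDual_apply, holLift_one_tmul]
  simp only [map_add, conjV_tmul, map_one, map_neg, Complex.conj_I, neg_neg, antiholForm_tmul,
    snd_mk, TensorProduct.tmul_zero, mul_one, fst_mk, zero_add, Complex.I_mul_I, add_zero,
    LinearMap.BilinForm.baseChange_tmul, one_mul, Complex.real_smul, map_mul, Complex.conj_ofReal,
    mul_neg, neg_mul]
  ring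

theorem isModel_complexMap [FiniteDimensional ℝ 𝔤] (hω : ω.IsAlt) (hγ : IsTorsionFree γ)
    (hγω : IsSymplecticConnection γ ω) (hJ : IsComplexStructure (J γ)) :
    (ofComplex (J γ) hJ).IsModel (Ω₁ γ ω) (complexMap ω hJ) := by
  refine .of_real (fun a b => Subtype.ext (Prod.ext (holLift_lie hγ _ _) ?_)) fun a b => ?_
  · change antiholDual γ ω (1 ⊗ₜ (γ (fst γ a) (snd γ b) - γ (fst γ b) (snd γ a))) =
      lieDer (holLift γ (1 ⊗ₜ fst γ a)) (antiholDual γ ω (1 ⊗ₜ snd γ b)) -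
        lieDer (holLift γ (1 ⊗ₜ fst γ b)) (antiholDual γ ω (1 ⊗ₜ snd γ a))
    rw [lieDer_antiholDual hγ hγω, lieDer_antiholDual hγ hγω, ← map_sub, TensorProduct.tmul_sub]
  · have hol_conj : antiholDual γ ω (1 ⊗ₜ snd γ b) (conjV (holLift γ (1 ⊗ₜ fst γ a))) =
        2 * Complex.I * ω (snd γ b) (fst γ a) := by
      have := congrArg (starRingEnd ℂ) (conjD_antiholDual (γ := γ) (ω := ω) (snd γ b) (fst γ a))
      simpa [conjD_apply, map_ofNat] using this
    rw [sigma_apply, coe_complexMap, coe_complexMap, conjE_apply, conjD_antiholDual, hol_conj,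
      Ω₁_apply, ← hω.neg_eq (fst γ a)]
    push_cast
    ring

end SemiProd

end ComplexModel

section Main

variable {𝔤 : Type*} [LieRing 𝔤] [LieAlgebra ℝ 𝔤] [FiniteDimensional ℝ 𝔤]
  {γ : FlatConnection 𝔤} {ω g : LinearMap.BilinForm ℝ 𝔤}

namespace SemiProd

theorem nonempty_dgaEquiv_J_Ω₂ (hω : IsSymplectic ω) (hg : IsPseudoMetric g)
    (hγ : IsTorsionFree γ) (hγω : IsSymplecticConnection γ ω)
    (hJ : IsComplexStructure (J γ)) (hΩ₂ : IsSymplectic (Ω₂ γ ω))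
    (closed : IsClosedForm (Δ γ g ∘ₗ J γ))
    (hT : ∀ a b, invComp g hg.nondegenerate ω (γ a b) =
      γ (invComp g hg.nondegenerate ω a) (invComp g hg.nondegenerate ω b)) :
    Nonempty (GenComplex.DGAEquiv (ofComplex (J γ) hJ) (ofSymplectic (Ω₂ γ ω) hΩ₂)) := by
  obtain ⟨A, hA⟩ := exists_lieEquiv_Ω₂_eq_Ω₁ (ω := ω) hγ hT
    (connection_invComp_invComp hω.nondegenerate hg hγω hT)
    (connection_sub_invComp_symm hω.nondegenerate hg hγ hγω hT closed)
    (skew_invComp hω.isAlt hg)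
  exact (isModel_complexMap hω.isAlt hγ hγω hJ).nonempty_dgaEquiv
    ((isModel_symplecticMap hΩ₂).comp_lieHom A.toLieHom hA)
    (isSymplectic_Ω₁ hω hγ hγω).nondegenerate rfl rfl

theorem exists_deform_J_eq_Ω₂ (hω : IsSymplectic ω) (hγ : IsTorsionFree γ)
    (hγω : IsSymplecticConnection γ ω) (hJ : IsComplexStructure (J γ))
    (hΩ₂ : IsSymplectic (Ω₂ γ ω)) :
    ∃ Λ ∈ ⋀[ℂ]^2 (ofComplex (J γ) hJ).L,
      (∀ t : ℝ, IsGenComplex ((ofComplex (J γ) hJ).deform ((t : ℂ) • Λ))) ∧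
      (ofComplex (J γ) hJ).deform Λ = (ofSymplectic (Ω₂ γ ω) hΩ₂).L.map (bField (Ω₁ γ ω)) := by
  have hΩ₁ := isSymplectic_Ω₁ hω hγ hγω
  rw [Ω₁_eq_Ω₂_comp_J] at hΩ₁ ⊢
  exact exists_deform_ofComplex_eq hJ hΩ₂ hΩ₁.isAlt hΩ₁.closed

end SemiProd

end Main

end

end GenGeom

open GenGeom in
theorem theorem5p6_general {𝔤 : Type*} [LieRing 𝔤] [LieAlgebra ℝ 𝔤] [FiniteDimensional ℝ 𝔤]
    (ω : LinearMap.BilinForm ℝ 𝔤) (hω : IsSymplectic ω)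
    (g : LinearMap.BilinForm ℝ 𝔤) (hg : IsPseudoMetric g)
    (γ : FlatConnection 𝔤) (hγ_torsion : IsTorsionFree γ) (hγ_symp : IsSymplecticConnection γ ω) :
    ∃ (hJ : IsComplexStructure (SemiProd.J γ)) (hΩ₂ : IsSymplectic (SemiProd.Ω₂ γ ω)),
      IsSymplectic (SemiProd.Ω₁ γ ω) ∧ IsSymplectic (SemiProd.Ω₃ γ ω) ∧
      IsPseudoMetric (SemiProd.Δ γ g) ∧
      (∃ Λ ∈ ⋀[ℂ]^2 (ofComplex (SemiProd.J γ) hJ).L,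
        (∀ t : ℝ, IsGenComplex ((ofComplex (SemiProd.J γ) hJ).deform ((t : ℂ) • Λ))) ∧
        (ofComplex (SemiProd.J γ) hJ).deform Λ =
          (ofSymplectic (SemiProd.Ω₂ γ ω) hΩ₂).L.map (bField (SemiProd.Ω₁ γ ω))) ∧
      (IsPseudoKahler (SemiProd.J γ) (SemiProd.Δ γ g) →
        (∀ a b, invComp g hg.nondegenerate ω (γ a b) =
          γ (invComp g hg.nondegenerate ω a) (invComp g hg.nondegenerate ω b)) →
        Nonempty (GenComplex.DGAEquiv (ofComplex (SemiProd.J γ) hJ)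
          (ofSymplectic (SemiProd.Ω₂ γ ω) hΩ₂))) := by
  have hJ := SemiProd.isComplexStructure_J hγ_torsion
  have hΩ₂ := SemiProd.isSymplectic_Ω₂ hω hγ_symp
  exact ⟨hJ, hΩ₂, SemiProd.isSymplectic_Ω₁ hω hγ_torsion hγ_symp,
    SemiProd.isSymplectic_Ω₃ hω hγ_symp, SemiProd.isPseudoMetric_Δ γ hg,
    SemiProd.exists_deform_J_eq_Ω₂ hω hγ_torsion hγ_symp hJ hΩ₂, fun hKähler hT =>
    SemiProd.nonempty_dgaEquiv_J_Ω₂ hω hg hγ_torsion hγ_symp hJ hΩ₂ hKähler.closed hT⟩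

open GenGeom in
theorem theorem5p6 {𝔤 : Type*} [LieRing 𝔤] [LieAlgebra ℝ 𝔤] [FiniteDimensional ℝ 𝔤]
    (ω : LinearMap.BilinForm ℝ 𝔤) (hω : IsSymplectic ω)
    (g : LinearMap.BilinForm ℝ 𝔤) (hg : IsPseudoMetric g)
    (γ : FlatConnection 𝔤) (hγ_torsion : IsTorsionFree γ) (hγ_symp : IsSymplecticConnection γ ω) :
    ∃ (hJ : IsComplexStructure (SemiProd.J γ)) (hΩ₂ : IsSymplectic (SemiProd.Ω₂ γ ω)),
      IsSymplectic (SemiProd.Ω₁ γ ω) ∧ IsSymplectic (SemiProd.Ω₃ γ ω) ∧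
      IsPseudoMetric (SemiProd.Δ γ g) ∧
      (IsPseudoKahler (SemiProd.J γ) (SemiProd.Δ γ g) →
        (∀ a b, invComp g hg.nondegenerate ω (γ a b) =
          γ (invComp g hg.nondegenerate ω a) (invComp g hg.nondegenerate ω b)) →
        (∃ Λ ∈ ⋀[ℂ]^2 (ofComplex (SemiProd.J γ) hJ).L,
          (∀ t : ℝ, IsGenComplex ((ofComplex (SemiProd.J γ) hJ).deform ((t : ℂ) • Λ))) ∧
          (ofComplex (SemiProd.J γ) hJ).deform Λ =
            (ofSymplectic (SemiProd.Ω₂ γ ω) hΩ₂).L.map (bField (SemiProd.Ω₁ γ ω))) ∧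
        Nonempty (GenComplex.DGAEquiv (ofComplex (SemiProd.J γ) hJ)
          (ofSymplectic (SemiProd.Ω₂ γ ω) hΩ₂))) := by
  obtain ⟨hJ, hΩ₂, hΩ₁, hΩ₃, hΔ, deformation, dga⟩ :=
    theorem5p6_general ω hω g hg γ hγ_torsion hγ_symp
  exact ⟨hJ, hΩ₂, hΩ₁, hΩ₃, hΔ, fun hKähler hT => ⟨deformation, dga hKähler hT⟩⟩
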